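/- Let $\Bbbk$ be a non-zero commutative ring in which $2a=0$ implies $a=0$. Let $\mathfrak g=\mathfrak g_0\oplus\mathfrak g_1$ be a Lie superalgebra over $\Bbbk$: a $\mathbb Z/2$-graded $\Bbbk$-module with a graded bilinear super-bracket such that $[u,u]=0$ for $u\in\mathfrak g_0$, $[[v,v],v]=0$ for $v\in\mathfrak g_1$, and, for homogeneous $x,y,z$, $[x,y]+(-1)^{|x||y|}[y,x]=0$ and $[[x,y],z]+(-1)^{|x|(|y|+|z|)}[[y,z],x]+(-1)^{(|x|+|y|)|z|}[[z,x],y]=0$. Suppose that $\mathfrak g$ is admissible: $\mathfrak g_0$ is $\Bbbk$-flat, $\mathfrak g_1$ is $\Bbbk$-free, and for every $v\in\mathfrak g_1$ there is $u\in\mathfrak g_0$ (necessarily unique, written $\frac12[v,v]$) with $[v,v]=2u$. Let $\mathbf U(\mathfrak g)$ be the quotient of the tensor algebra $\mathbf T(\mathfrak g)$ by the ideal generated by $zw-(-1)^{|z||w|}wz-[z,w]$ ($z,w\in\mathfrak g$ homogeneous) and $v^2-\frac12[v,v]$ ($v\in\mathfrak g_1$), a Hopf superalgebra in which the elements of $\mathfrak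 g_0$ (resp. $\mathfrak g_1$) are even (resp. odd) primitives. Let $U(\mathfrak g_0)$ be the usual enveloping algebra of the Lie algebra $\mathfrak g_0$, a purely even Hopf algebra, which acts on $\mathbf U(\mathfrak g)$ by left and right multiplication through the map $U(\mathfrak g_0)\to\mathbf U(\mathfrak g)$ induced by $\mathfrak g_0\subset\mathfrak g$. Let $\wedge(\mathfrak g_1)$ be the exterior algebra, with its Hopf superalgebra structure in which the elements of $\mathfrak g_1$ are odd primitives. Then: (1) $\mathbf U(\mathfrak g)$ is free as a left and as a right $U(\mathfrak g_0)$-module. In fact, for every totally ordered $\Bbbk$-free basis $X$ of $\mathfrak g_1$, the products $x_1\cdots x_n$ in $\mathbf U(\mathfrak g)$, with $x_i\in X$, $x_1<\dots<x_n$, $n\ge 0$, form a basis of $\mathbf U(\mathfrak g)$ as a left $U(\mathfrak g_0)$-module, and also as a right $U(\mathfrak g_0)$-module. (2) There is an isomorphism $U(\mathfrak g_0)\otimes_{\Bbbk}\wedge(\mathfrak g_1)\to\mathbf U(\mathfrak g)$ of left $U(\mathfrak g_0)$-modules and of super-coalgebras (that is, it also preserves the grading, the coproduct and the counit) which sends $1\otimes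 1$ to $1$. -/

import Mathlib

open scoped TensorProduct DirectSum

noncomputable section

/-! ### Super-coalgebras whose coproduct is determined by primitive generators

A super-coalgebra over `k` is a `ZMod 2`-graded module with a coproduct and a counit that preserve
the grading and satisfy the usual (unsigned) coassociativity and counit laws; it is therefore
encoded as a `Coalgebra` together with a grading. Signs enter only through the product of
`A ⊗ A`, which is Mathlib's `GradedTensorProduct`. -/

namespace SuperAux

variable {k A : Type*} [CommRing k] [Ring A] [Algebra k A]
variable (𝒜 : ZMod 2 → Submodule k A) [GradedAlgebra 𝒜]

/-- The operator `a ↦ (-1)^(|a| d) a`. -/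
def parity (d : ZMod 2) : A →ₗ[k] A :=
  DirectSum.coeLinearMap 𝒜 ∘ₗ
    DirectSum.lmap (fun i => (((-1 : ℤˣ) ^ (i * d) : ℤˣ) : ℤ) • (LinearMap.id : 𝒜 i →ₗ[k] 𝒜 i)) ∘ₗ
    (DirectSum.decomposeLinearEquiv 𝒜).toLinearMap

theorem parity_coe (d : ZMod 2) {i : ZMod 2} {a : A} (ha : a ∈ 𝒜 i) :
    parity 𝒜 d a = (-1 : ℤˣ) ^ (i * d) • a := by
  lift a to 𝒜 i using ha
  simp [parity, Units.smul_def]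

theorem parity_one (d : ZMod 2) : parity 𝒜 d 1 = 1 := by
  rw [parity_coe 𝒜 d (SetLike.GradedOne.one_mem (A := 𝒜))]
  simp

theorem parity_mul (d e : ZMod 2) {s : A} (hs : s ∈ 𝒜 e) (x : A) :
    parity 𝒜 d (s * x) = (-1 : ℤˣ) ^ (e * d) • (s * parity 𝒜 d x) := by
  induction x using DirectSum.Decomposition.inductionOn 𝒜 with
  | zero => simp
  | @homogeneous i m =>
    rw [parity_coe 𝒜 d m.2, parity_coe 𝒜 d (SetLike.GradedMul.mul_mem hs m.2), add_mul,
      uzpow_add, mul_smul, mul_smul_comm]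
  | add a b ha hb => rw [mul_add, map_add, ha, hb, map_add, mul_add, smul_add]

/-- Left multiplication by `s ⊗ 1 + 1 ⊗ s`, for `s` of degree `d`. -/
def primMul (d : ZMod 2) (s : A) : A ⊗[k] A →ₗ[k] A ⊗[k] A :=
  TensorProduct.map (LinearMap.mulLeft k s) LinearMap.id +
    TensorProduct.map (parity 𝒜 d) (LinearMap.mulLeft k s)

theorem prim_mul {d : ZMod 2} {s : A} (hs : s ∈ 𝒜 d) (t : A ⊗[k] A) :
    (s ᵍ⊗ₜ[k] 1 + 1 ᵍ⊗ₜ[k] s : 𝒜 ᵍ⊗[k] 𝒜) * GradedTensorProduct.of k 𝒜 𝒜 t =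
      GradedTensorProduct.of k 𝒜 𝒜 (primMul 𝒜 d s t) := by
  induction t using TensorProduct.induction_on with
  | zero => simp
  | add x y hx hy => simp only [map_add, mul_add, hx, hy]
  | tmul a b =>
    induction a using DirectSum.Decomposition.inductionOn 𝒜 with
    | zero => simp
    | add x y hx hy => simp only [TensorProduct.add_tmul, map_add, mul_add, hx, hy]
    | @homogeneous i m =>
      rw [add_mul]
      have h1 := GradedTensorProduct.tmul_one_mul_coe_tmul 𝒜 𝒜 (R := k) s m b
      have h2 := GradedTensorProduct.tmul_coe_mul_coe_tmul 𝒜 𝒜 (R := k) 1 ⟨s, hs⟩ m b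
      simp only [one_mul] at h1 h2
      rw [h1, h2]
      simp only [primMul, LinearMap.add_apply, TensorProduct.map_tmul, parity_coe 𝒜 d m.2,
        mul_comm d i]
      obtain h | h := Int.units_eq_one_or ((-1 : ℤˣ) ^ (i * d)) <;>
        simp [h, TensorProduct.neg_tmul]

theorem prim_mul_prim {d e : ZMod 2} {s t : A} (hs : s ∈ 𝒜 d) (ht : t ∈ 𝒜 e) :
    (s ᵍ⊗ₜ[k] 1 + 1 ᵍ⊗ₜ[k] s : 𝒜 ᵍ⊗[k] 𝒜) * (t ᵍ⊗ₜ[k] 1 + 1 ᵍ⊗ₜ[k] t) =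
      (s * t) ᵍ⊗ₜ[k] 1 + s ᵍ⊗ₜ[k] t + (-1 : ℤˣ) ^ (d * e) • (t ᵍ⊗ₜ[k] s) +
        1 ᵍ⊗ₜ[k] (s * t) := by
  have h := prim_mul 𝒜 hs (t ⊗ₜ[k] 1 + 1 ⊗ₜ[k] t)
  rw [map_add] at h
  rw [h, mul_comm d e]
  simp only [primMul, LinearMap.add_apply, map_add, TensorProduct.map_tmul,
    LinearMap.mulLeft_apply, LinearMap.id_apply, mul_one, parity_one, parity_coe 𝒜 d ht]
  obtain h | h := Int.units_eq_one_or ((-1 : ℤˣ) ^ (e * d)) <;>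
    simp [h, TensorProduct.neg_tmul] <;> abel

/-- `s` is primitive, homogeneous of degree `d`, and killed by the counit. -/
structure IsPrim (Δ : A →ₐ[k] 𝒜 ᵍ⊗[k] 𝒜) (ε : A →ₐ[k] k) (d : ZMod 2) (s : A) : Prop where
  mem : s ∈ 𝒜 d
  comul : Δ s = s ᵍ⊗ₜ[k] 1 + 1 ᵍ⊗ₜ[k] s
  counit : ε s = 0

/-- The coproduct, as a linear map to the ordinary tensor product. -/
def lin (Δ : A →ₐ[k] 𝒜 ᵍ⊗[k] 𝒜) : A →ₗ[k] A ⊗[k] A :=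
  (GradedTensorProduct.of k 𝒜 𝒜).symm.toLinearMap ∘ₗ Δ.toLinearMap

variable {𝒜}
variable {Δ : A →ₐ[k] 𝒜 ᵍ⊗[k] 𝒜} {ε : A →ₐ[k] k}

theorem lin_one : lin 𝒜 Δ 1 = 1 ⊗ₜ 1 := by
  simp [lin, Algebra.TensorProduct.one_def]

theorem lin_mul {d : ZMod 2} {s : A} (hs : IsPrim 𝒜 Δ ε d s) (x : A) :
    lin 𝒜 Δ (s * x) = primMul 𝒜 d s (lin 𝒜 Δ x) := by
  have := prim_mul 𝒜 hs.mem (lin 𝒜 Δ x)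
  rw [← hs.comul] at this
  simp only [lin, LinearMap.comp_apply, AlgHom.toLinearMap_apply, LinearEquiv.coe_coe,
    GradedTensorProduct.symm_of_of, map_mul] at this ⊢
  rw [this]
  rfl

theorem eq_of_gen {M : Type*} [AddCommGroup M] [Module k M] (S : Set A)
    (hS : Algebra.adjoin k S = ⊤) (f g : A →ₗ[k] M) (h1 : f 1 = g 1)
    (hmul : ∀ s ∈ S, ∀ x, f x = g x → f (s * x) = g (s * x)) : f = g := by
  have key : ∀ x ∈ Submonoid.closure S, f x = g x := by
    intro x hx
    induction hx using Submonoid.closure_induction_left with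
    | one => exact h1
    | mul_left s hs y hy ih => exact hmul s hs y ih
  ext x
  have hx : x ∈ Submodule.span k (Submonoid.closure S : Set A) := by
    rw [← Algebra.adjoin_eq_span, hS]; trivial
  exact LinearMap.eqOn_span (fun y hy => key y hy) hx

/-- The set of homogeneous primitives. -/
def prims (Δ : A →ₐ[k] 𝒜 ᵍ⊗[k] 𝒜) (ε : A →ₐ[k] k) : Set A := {s | ∃ d, IsPrim 𝒜 Δ ε d s}

theorem lin_parity (hS : Algebra.adjoin k (prims Δ ε) = ⊤) (d : ZMod 2) :
    lin 𝒜 Δ ∘ₗ parity 𝒜 d = TensorProduct.map (parity 𝒜 d) (parity 𝒜 d) ∘ₗ lin 𝒜 Δ := by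
  refine eq_of_gen _ hS _ _ ?_ ?_
  · simp [parity_one, lin_one]
  · rintro s ⟨e, hs⟩ x hx
    simp only [LinearMap.comp_apply] at hx ⊢
    rw [parity_mul 𝒜 d e hs.mem, Units.smul_def, map_zsmul, lin_mul hs, lin_mul hs, hx]
    generalize lin 𝒜 Δ x = t
    induction t using TensorProduct.induction_on with
    | zero => simp
    | add x y hx hy => simp only [map_add, smul_add, hx, hy]
    | tmul a b =>
      have comm : parity 𝒜 e (parity 𝒜 d a) = parity 𝒜 d (parity 𝒜 e a) := by
        induction a using DirectSum.Decomposition.inductionOn 𝒜 with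
        | zero => simp
        | add x y hx hy => simp only [map_add, hx, hy]
        | @homogeneous i m =>
          simp only [parity_coe 𝒜 _ m.2, Units.smul_def, map_zsmul, smul_smul]
          rw [mul_comm]
      obtain h | h := Int.units_eq_one_or ((-1 : ℤˣ) ^ (e * d)) <;>
        simp [primMul, parity_mul 𝒜 d e hs.mem, comm, h, TensorProduct.neg_tmul,
          TensorProduct.tmul_neg, add_comm]

theorem counit_parity (hS : Algebra.adjoin k (prims Δ ε) = ⊤) (d : ZMod 2) :
    ε.toLinearMap ∘ₗ parity 𝒜 d = ε.toLinearMap := by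
  refine eq_of_gen _ hS _ _ ?_ ?_
  · simp [parity_one]
  · rintro s ⟨e, hs⟩ x hx
    simp only [LinearMap.comp_apply, AlgHom.toLinearMap_apply] at hx ⊢
    rw [parity_mul 𝒜 d e hs.mem, Units.smul_def, map_zsmul, map_mul, map_mul, hs.counit]
    simp

theorem coassoc (hS : Algebra.adjoin k (prims Δ ε) = ⊤) :
    (TensorProduct.assoc k A A A).toLinearMap ∘ₗ (lin 𝒜 Δ).rTensor A ∘ₗ lin 𝒜 Δ =
      (lin 𝒜 Δ).lTensor A ∘ₗ lin 𝒜 Δ := by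
  refine eq_of_gen _ hS _ _ ?_ ?_
  · simp [lin_one]
  · rintro s ⟨d, hs⟩ x hx
    simp only [LinearMap.comp_apply] at hx ⊢
    rw [lin_mul hs]
    let M : A ⊗[k] (A ⊗[k] A) →ₗ[k] A ⊗[k] (A ⊗[k] A) :=
      TensorProduct.map (LinearMap.mulLeft k s) LinearMap.id +
        TensorProduct.map (parity 𝒜 d) (primMul 𝒜 d s)
    have e1 : ∀ t, (TensorProduct.assoc k A A A).toLinearMap
        ((lin 𝒜 Δ).rTensor A (primMul 𝒜 d s t)) =
        M ((TensorProduct.assoc k A A A).toLinearMap ((lin 𝒜 Δ).rTensor A t)) := by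
      intro t
      induction t using TensorProduct.induction_on with
      | zero => simp
      | add x y hx hy => simp only [map_add, hx, hy]
      | tmul a b =>
        have hp := LinearMap.congr_fun (lin_parity hS d) a
        simp only [LinearMap.comp_apply] at hp
        simp only [primMul, LinearMap.add_apply, TensorProduct.map_tmul, LinearMap.mulLeft_apply,
          LinearMap.id_apply, map_add, LinearMap.rTensor_tmul, lin_mul hs, hp]
        generalize lin 𝒜 Δ a = t
        induction t using TensorProduct.induction_on with
        | zero => simp
        | add x y hx hy =>
          simp only [map_add, TensorProduct.add_tmul] at hx hy ⊢
          rw [← hx, ← hy]; abel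
        | tmul a c =>
          simp [M, primMul, TensorProduct.add_tmul, TensorProduct.tmul_add]
          abel
    have e2 : ∀ t, (lin 𝒜 Δ).lTensor A (primMul 𝒜 d s t) = M ((lin 𝒜 Δ).lTensor A t) := by
      intro t
      induction t using TensorProduct.induction_on with
      | zero => simp
      | add x y hx hy => simp only [map_add, hx, hy]
      | tmul a b => simp [M, primMul, lin_mul hs]
    rw [e1, e2, hx]

/-- The coalgebra attached to an algebra map `A → A ⊗ A` into the graded tensor product,
when `A` is generated by homogeneous primitives. -/
@[reducible]
def coalgebra (Δ : A →ₐ[k] 𝒜 ᵍ⊗[k] 𝒜) (ε : A →ₐ[k] k)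
    (hS : Algebra.adjoin k (prims Δ ε) = ⊤) : Coalgebra k A where
  comul := lin 𝒜 Δ
  counit := ε.toLinearMap
  coassoc := coassoc hS
  rTensor_counit_comp_comul := by
    refine eq_of_gen _ hS _ _ ?_ ?_
    · simp [lin_one]
    · rintro s ⟨d, hs⟩ x hx
      simp only [LinearMap.comp_apply] at hx ⊢
      have key : ∀ t, ε.toLinearMap.rTensor A (primMul 𝒜 d s t) =
          (LinearMap.mulLeft k s).lTensor k (ε.toLinearMap.rTensor A t) := by
        intro t
        induction t using TensorProduct.induction_on with
        | zero => simp
        | add x y hx hy => simp only [map_add, hx, hy]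
        | tmul a b =>
          have hp := LinearMap.congr_fun (counit_parity hS d) a
          simp only [LinearMap.comp_apply, AlgHom.toLinearMap_apply] at hp
          simp [primMul, hs.counit, hp]
      rw [lin_mul hs, key, hx]
      simp
  lTensor_counit_comp_comul := by
    refine eq_of_gen _ hS _ _ ?_ ?_
    · simp [lin_one]
    · rintro s ⟨d, hs⟩ x hx
      simp only [LinearMap.comp_apply] at hx ⊢
      have key : ∀ t, ε.toLinearMap.lTensor A (primMul 𝒜 d s t) =
          (LinearMap.mulLeft k s).rTensor k (ε.toLinearMap.lTensor A t) := by
        intro t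
        induction t using TensorProduct.induction_on with
        | zero => simp
        | add x y hx hy => simp only [map_add, hx, hy]
        | tmul a b => simp [primMul, hs.counit]
      rw [lin_mul hs, key, hx]
      simp

end SuperAux

/-! ### Lie superalgebras -/

/-- A Lie superalgebra over `k` with underlying module `g`: a `ZMod 2`-grading of `g` and a
super-bracket. -/
structure LieSuperalgebra (k g : Type*) [CommRing k] [AddCommGroup g] [Module k g] where
  /-- the even component `gr 0` and the odd component `gr 1` -/
  gr : ZMod 2 → Submodule k g
  isInternal : DirectSum.IsInternal gr
  /-- the super-bracket -/
  bracket : g →ₗ[k] g →ₗ[k] g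
  bracket_mem : ∀ {i j : ZMod 2} {z w : g}, z ∈ gr i → w ∈ gr j → bracket z w ∈ gr (i + j)
  bracket_even_self : ∀ u ∈ gr 0, bracket u u = 0
  bracket_odd_self : ∀ v ∈ gr 1, bracket (bracket v v) v = 0
  super_skew : ∀ {i j : ZMod 2} {z w : g}, z ∈ gr i → w ∈ gr j →
    bracket z w + (-1 : ℤˣ) ^ (i * j) • bracket w z = 0
  super_jacobi : ∀ {i j l : ZMod 2} {x y z : g}, x ∈ gr i → y ∈ gr j → z ∈ gr l →
    bracket (bracket x y) z + (-1 : ℤˣ) ^ (i * (j + l)) • bracket (bracket y z) x +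
      (-1 : ℤˣ) ^ ((i + j) * l) • bracket (bracket z x) y = 0

namespace LieSuperalgebra

variable {k g : Type*} [CommRing k] [AddCommGroup g] [Module k g] (L : LieSuperalgebra k g)

/-- Admissibility: the even part is flat, the odd part is free, and `[v, v]` is `2`-divisible in
the even part for every odd `v`. -/
structure Admissible : Prop where
  flat_even : Module.Flat k (L.gr 0)
  free_odd : Module.Free k (L.gr 1)
  two_dvd : ∀ v ∈ L.gr 1, ∃ u ∈ L.gr 0, L.bracket v v = (2 : ℕ) • u

/-- The even component of a Lie superalgebra is a Lie algebra. -/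
instance : LieRing (L.gr 0) where
  bracket x y := ⟨L.bracket x y, by simpa using L.bracket_mem x.2 y.2⟩
  add_lie x y z := by ext; simp
  lie_add x y z := by ext; simp
  lie_self x := by ext; simpa [Bracket.bracket] using L.bracket_even_self x x.2
  leibniz_lie x y z := by
    have e : ∀ a b c : L.gr 0, L.bracket (L.bracket a b) c = - L.bracket c (L.bracket a b) := by
      intro a b c
      have := L.super_skew (L.bracket_mem a.2 b.2) c.2
      simpa [add_eq_zero_iff_eq_neg] using this
    have s : ∀ a b : L.gr 0, L.bracket (a : g) b = - L.bracket (b : g) a := by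
      intro a b
      have := L.super_skew a.2 b.2
      simpa [add_eq_zero_iff_eq_neg] using this
    have j := L.super_jacobi x.2 y.2 z.2
    simp only [mul_zero, add_zero, uzpow_zero, one_smul] at j
    rw [e y z x, e z x y, s z x, map_neg, neg_neg] at j
    ext
    change L.bracket x (L.bracket y z) =
      L.bracket (L.bracket x y) z + L.bracket y (L.bracket x z)
    rw [add_right_comm, add_neg_eq_zero] at j
    exact j.symm

@[simp] theorem coe_lie (x y : L.gr 0) : ((⁅x, y⁆ : L.gr 0) : g) = L.bracket x y := rfl

instance : LieAlgebra k (L.gr 0) where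
  lie_smul t x y := by ext; simp

/-! ### The universal envelope -/

/-- The defining relations of the universal envelope in the tensor algebra. For an admissible Lie
superalgebra over a `2`-torsion free ring, the element `u` in the second relation exists and is
unique; it is `½[v, v]`. -/
inductive Rel : TensorAlgebra k g → TensorAlgebra k g → Prop
  | comm {i j : ZMod 2} {z w : g} (hz : z ∈ L.gr i) (hw : w ∈ L.gr j) :
      Rel (TensorAlgebra.ι k z * TensorAlgebra.ι k w -
        (-1 : ℤˣ) ^ (i * j) • (TensorAlgebra.ι k w * TensorAlgebra.ι k z))
        (TensorAlgebra.ι k (L.bracket z w))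
  | sq {v u : g} (hv : v ∈ L.gr 1) (hu : u ∈ L.gr 0) (h : L.bracket v v = (2 : ℕ) • u) :
      Rel (TensorAlgebra.ι k v * TensorAlgebra.ι k v) (TensorAlgebra.ι k u)

/-- The universal envelope `𝐔(g)`. -/
def Envelope : Type _ := RingQuot L.Rel

instance : Ring L.Envelope := inferInstanceAs (Ring (RingQuot L.Rel))
instance : Algebra k L.Envelope := inferInstanceAs (Algebra k (RingQuot L.Rel))

/-- The quotient map from the tensor algebra. -/
def toEnvelope : TensorAlgebra k g →ₐ[k] L.Envelope := RingQuot.mkAlgHom k L.Rel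

theorem toEnvelope_surjective : Function.Surjective L.toEnvelope := RingQuot.mkAlgHom_surjective k L.Rel

/-- The canonical map `g → 𝐔(g)`. -/
def ι : g →ₗ[k] L.Envelope := L.toEnvelope.toLinearMap ∘ₗ TensorAlgebra.ι k

theorem ι_comm {i j : ZMod 2} {z w : g} (hz : z ∈ L.gr i) (hw : w ∈ L.gr j) :
    L.ι z * L.ι w - (-1 : ℤˣ) ^ (i * j) • (L.ι w * L.ι z) = L.ι (L.bracket z w) := by
  have := RingQuot.mkAlgHom_rel k (Rel.comm (L := L) hz hw)
  change L.toEnvelope _ = L.toEnvelope _ at this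
  simp only [map_sub, map_mul, Units.smul_def, map_zsmul] at this
  exact this

theorem ι_sq {v u : g} (hv : v ∈ L.gr 1) (hu : u ∈ L.gr 0)
    (h : L.bracket v v = (2 : ℕ) • u) : L.ι v * L.ι v = L.ι u := by
  have := RingQuot.mkAlgHom_rel k (Rel.sq (L := L) hv hu h)
  change L.toEnvelope _ = L.toEnvelope _ at this
  rw [map_mul] at this
  exact this

section lift

variable {B : Type*} [Ring B] [Algebra k B]

/-- The algebra map out of the universal envelope induced by a linear map that respects the
defining relations. -/
def lift (f : g →ₗ[k] B)
    (hc : ∀ {i j : ZMod 2} {z w : g}, z ∈ L.gr i → w ∈ L.gr j →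
      f z * f w - (-1 : ℤˣ) ^ (i * j) • (f w * f z) = f (L.bracket z w))
    (hs : ∀ {v u : g}, v ∈ L.gr 1 → u ∈ L.gr 0 → L.bracket v v = (2 : ℕ) • u →
      f v * f v = f u) : L.Envelope →ₐ[k] B :=
  RingQuot.liftAlgHom k ⟨TensorAlgebra.lift k f, by
    intro x y h
    induction h with
    | comm hz hw =>
      simpa only [map_sub, map_mul, Units.smul_def, map_zsmul, TensorAlgebra.lift_ι_apply]
        using hc hz hw
    | sq hv hu h => simpa only [map_mul, TensorAlgebra.lift_ι_apply] using hs hv hu h⟩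

@[simp] theorem lift_ι (f : g →ₗ[k] B) (hc) (hs) (z : g) : L.lift f hc hs (L.ι z) = f z := by
  change RingQuot.liftAlgHom k _ (RingQuot.mkAlgHom k L.Rel (TensorAlgebra.ι k z)) = f z
  rw [RingQuot.liftAlgHom_mkAlgHom_apply, TensorAlgebra.lift_ι_apply]

theorem hom_ext {f₁ f₂ : L.Envelope →ₐ[k] B} (h : ∀ z, f₁ (L.ι z) = f₂ (L.ι z)) : f₁ = f₂ := by
  have : f₁.comp L.toEnvelope = f₂.comp L.toEnvelope := TensorAlgebra.hom_ext (LinearMap.ext h)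
  ext x
  obtain ⟨t, rfl⟩ := L.toEnvelope_surjective x
  exact DFunLike.congr_fun this t

end lift

/-- The grading of the universal envelope: the degree `d` part is spanned by the products
`z₁ ⋯ zₙ` of homogeneous elements of `g` with `|z₁| + ⋯ + |zₙ| = d`. -/
def grEnvelope (d : ZMod 2) : Submodule k L.Envelope :=
  Submodule.span k {x | ∃ l : List (Σ i, L.gr i),
    (l.map Sigma.fst).sum = d ∧ (l.map fun z => L.ι (z.2 : g)).prod = x}

theorem ι_mem {i : ZMod 2} {z : g} (hz : z ∈ L.gr i) : L.ι z ∈ L.grEnvelope i :=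
  Submodule.subset_span ⟨[⟨i, z, hz⟩], by simp⟩

instance : SetLike.GradedMonoid L.grEnvelope where
  one_mem := Submodule.subset_span ⟨[], by simp⟩
  mul_mem i j x y hx hy := by
    have : L.grEnvelope i * L.grEnvelope j ≤ L.grEnvelope (i + j) := by
      rw [grEnvelope, grEnvelope, Submodule.span_mul_span, Submodule.span_le]
      rintro _ ⟨_, ⟨l, rfl, rfl⟩, _, ⟨m, rfl, rfl⟩, rfl⟩
      exact Submodule.subset_span ⟨l ++ m, by simp⟩
    exact this (Submodule.mul_mem_mul hx hy)

/-- The linear map underlying the decomposition of the universal envelope. -/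
def toGraded : g →ₗ[k] ⨁ i, L.grEnvelope i :=
  letI := L.isInternal.chooseDecomposition
  DirectSum.lmap (fun i => (L.ι.restrict (fun _ h => L.ι_mem h) : L.gr i →ₗ[k] L.grEnvelope i)) ∘ₗ
    (DirectSum.decomposeLinearEquiv L.gr).toLinearMap

theorem toGraded_of_mem {i : ZMod 2} {z : g} (hz : z ∈ L.gr i) :
    L.toGraded z = DirectSum.of (fun i => L.grEnvelope i) i ⟨L.ι z, L.ι_mem hz⟩ := by
  let := L.isInternal.chooseDecomposition
  lift z to L.gr i using hz
  simp only [toGraded, LinearMap.comp_apply, LinearEquiv.coe_coe,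
    DirectSum.decomposeLinearEquiv_apply, DirectSum.decompose_coe, DirectSum.lmap_of]
  rfl

theorem homogeneous_induction {p : g → Prop} (h0 : p 0)
    (hm : ∀ {i : ZMod 2} {z : g}, z ∈ L.gr i → p z) (ha : ∀ z w, p z → p w → p (z + w)) (z : g) :
    p z := by
  let := L.isInternal.chooseDecomposition
  exact DirectSum.Decomposition.inductionOn L.gr h0 (fun m => hm m.2) ha z

theorem coe_toGraded (z : g) :
    DirectSum.coeAlgHom L.grEnvelope (L.toGraded z) = L.ι z := by
  induction z using L.homogeneous_induction with
  | h0 => simp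
  | hm hz => rw [L.toGraded_of_mem hz, DirectSum.coeAlgHom_of]
  | ha z w hz hw => rw [map_add, map_add, map_add, hz, hw]

theorem toGraded_comm {i j : ZMod 2} {z w : g} (hz : z ∈ L.gr i) (hw : w ∈ L.gr j) :
    L.toGraded z * L.toGraded w - (-1 : ℤˣ) ^ (i * j) • (L.toGraded w * L.toGraded z) =
      L.toGraded (L.bracket z w) := by
  have hb := L.bracket_mem hz hw
  rw [L.toGraded_of_mem hz, L.toGraded_of_mem hw, L.toGraded_of_mem hb,
    DirectSum.of_mul_of, DirectSum.of_mul_of]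
  have e : ∀ (a b : ZMod 2) (x : L.Envelope) (ha : x ∈ L.grEnvelope a)
      (hb : x ∈ L.grEnvelope b), a = b →
      DirectSum.of (fun i => L.grEnvelope i) a ⟨x, ha⟩ =
        DirectSum.of (fun i => L.grEnvelope i) b ⟨x, hb⟩ := by
    rintro a b x ha hb rfl; rfl
  have h2 := e (j + i) (i + j) (L.ι w * L.ι z)
    (SetLike.GradedMul.mul_mem (L.ι_mem hw) (L.ι_mem hz))
    (add_comm j i ▸ SetLike.GradedMul.mul_mem (L.ι_mem hw) (L.ι_mem hz)) (add_comm j i)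
  change _ - _ • DirectSum.of (fun i => L.grEnvelope i) (j + i) ⟨L.ι w * L.ι z, _⟩ = _
  rw [h2, Units.smul_def, ← map_zsmul (DirectSum.of (fun i => L.grEnvelope i) (i + j)),
    sub_eq_iff_eq_add, ← map_add]
  congr 1
  ext
  simpa [Units.smul_def, sub_eq_iff_eq_add] using L.ι_comm hz hw

theorem toGraded_sq {v u : g} (hv : v ∈ L.gr 1) (hu : u ∈ L.gr 0)
    (h : L.bracket v v = (2 : ℕ) • u) : L.toGraded v * L.toGraded v = L.toGraded u := by
  rw [L.toGraded_of_mem hv, L.toGraded_of_mem hu, DirectSum.of_mul_of]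
  exact DirectSum.of_eq_of_gradedMonoid_eq (Sigma.subtype_ext rfl (L.ι_sq hv hu h))

/-- The decomposition of the universal envelope. -/
def decomp : L.Envelope →ₐ[k] ⨁ i, L.grEnvelope i :=
  L.lift (B := ⨁ i, L.grEnvelope i) L.toGraded L.toGraded_comm L.toGraded_sq

instance : GradedAlgebra L.grEnvelope :=
  GradedAlgebra.ofAlgHom L.grEnvelope L.decomp
    (L.hom_ext fun z => by simpa [decomp] using L.coe_toGraded z)
    (by
      rintro i ⟨x, hx⟩
      induction hx using Submodule.span_induction with
      | mem x hx =>
        obtain ⟨l, rfl, rfl⟩ := hx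
        dsimp only
        induction l with
        | nil => simp only [List.map_nil, List.prod_nil, map_one]; rfl
        | cons z l ih =>
          simp only [List.map_cons, List.prod_cons, map_mul]
          rw [ih, decomp, lift_ι, L.toGraded_of_mem z.2.2, DirectSum.of_mul_of]
          rfl
      | zero => rw [map_zero]; exact (map_zero (DirectSum.of (fun i => L.grEnvelope i) i)).symm
      | add x y hx hy ihx ihy =>
        dsimp only at ihx ihy ⊢
        rw [map_add, ihx, ihy, ← map_add]; rfl
      | smul c x hx ih =>
        dsimp only at ih ⊢
        rw [map_smul, ih, ← DirectSum.lof_eq_of k, ← map_smul]; rfl)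

/-! ### The super-coalgebra structure of the universal envelope -/

/-- The map `z ↦ z ⊗ 1 + 1 ⊗ z`. -/
def primitive : g →ₗ[k] L.grEnvelope ᵍ⊗[k] L.grEnvelope :=
  ((GradedTensorProduct.includeLeft L.grEnvelope L.grEnvelope).toLinearMap +
    (GradedTensorProduct.includeRight L.grEnvelope L.grEnvelope).toLinearMap) ∘ₗ L.ι

theorem primitive_apply (z : g) :
    L.primitive z = (L.ι z) ᵍ⊗ₜ[k] 1 + 1 ᵍ⊗ₜ[k] (L.ι z) := rfl

theorem primitive_mul {i j : ZMod 2} {z w : g} (hz : z ∈ L.gr i) (hw : w ∈ L.gr j) :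
    L.primitive z * L.primitive w =
      (L.ι z * L.ι w) ᵍ⊗ₜ[k] 1 + (L.ι z) ᵍ⊗ₜ[k] (L.ι w) +
        (-1 : ℤˣ) ^ (i * j) • ((L.ι w) ᵍ⊗ₜ[k] (L.ι z)) + 1 ᵍ⊗ₜ[k] (L.ι z * L.ι w) := by
  exact SuperAux.prim_mul_prim L.grEnvelope (L.ι_mem hz) (L.ι_mem hw)

/-- The coproduct of `𝐔(g)`: the superalgebra map for which the elements of `g` are primitive. -/
def comulAlgHom : L.Envelope →ₐ[k] L.grEnvelope ᵍ⊗[k] L.grEnvelope :=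
  L.lift L.primitive
    (by
      intro i j z w hz hw
      rw [L.primitive_mul hz hw, L.primitive_mul hw hz, primitive_apply, ← L.ι_comm hz hw,
        mul_comm j i]
      obtain h | h := Int.units_eq_one_or ((-1 : ℤˣ) ^ (i * j)) <;>
        simp [h, TensorProduct.sub_tmul, TensorProduct.tmul_sub, TensorProduct.add_tmul,
          TensorProduct.tmul_add, GradedTensorProduct.tmul] <;> abel)
    (by
      intro v u hv hu h
      rw [L.primitive_mul hv hv, L.ι_sq hv hu h, primitive_apply]
      simp)

/-- The counit of `𝐔(g)`, which kills the elements of `g`. -/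
def counitAlgHom : L.Envelope →ₐ[k] k := L.lift 0 (by simp) (by simp)

theorem adjoin_prims :
    Algebra.adjoin k (SuperAux.prims L.comulAlgHom L.counitAlgHom) = ⊤ := by
  have h1 : Algebra.adjoin k (Set.range L.ι) = ⊤ := by
    have : Set.range L.ι = L.toEnvelope '' Set.range (TensorAlgebra.ι k) := by
      rw [← Set.range_comp]; rfl
    rw [this, ← AlgHom.map_adjoin, TensorAlgebra.adjoin_range_ι, Algebra.map_top,
      AlgHom.range_eq_top]
    exact L.toEnvelope_surjective
  rw [eq_top_iff, ← h1, Algebra.adjoin_le_iff]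
  rintro _ ⟨z, rfl⟩
  induction z using L.homogeneous_induction with
  | h0 => rw [map_zero]; exact zero_mem _
  | @hm i z hz =>
    exact Algebra.subset_adjoin ⟨i, L.ι_mem hz, by rw [comulAlgHom, lift_ι]; rfl,
      by simp [counitAlgHom]⟩
  | ha z w hz hw => rw [map_add]; exact add_mem hz hw

instance : Coalgebra k L.Envelope :=
  SuperAux.coalgebra L.comulAlgHom L.counitAlgHom L.adjoin_prims

end LieSuperalgebra

/-! ### The Hopf algebra structure of the enveloping algebra of a Lie algebra -/

namespace LieEnvelope

attribute [local instance 2000] LieRing.ofAssociativeRing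

variable (k h : Type*) [CommRing k] [LieRing h] [LieAlgebra k h]

/-- The coproduct of `U(h)`, for which the elements of `h` are primitive. -/
def comulAlgHom : UniversalEnvelopingAlgebra k h →ₐ[k]
    UniversalEnvelopingAlgebra k h ⊗[k] UniversalEnvelopingAlgebra k h :=
  UniversalEnvelopingAlgebra.lift k
    { toFun := fun x => UniversalEnvelopingAlgebra.ι k x ⊗ₜ 1 + 1 ⊗ₜ UniversalEnvelopingAlgebra.ι k x
      map_add' := fun x y => by
        simp only [map_add, TensorProduct.add_tmul, TensorProduct.tmul_add]; abel
      map_smul' := fun c x => by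
        simp only [map_smul, TensorProduct.smul_tmul', TensorProduct.tmul_smul, smul_add,
          RingHom.id_apply]
      map_lie' := fun {x y} => by
        simp only [LieHom.map_lie, LieRing.of_associative_ring_bracket, TensorProduct.sub_tmul,
          TensorProduct.tmul_sub, mul_add, add_mul, Algebra.TensorProduct.tmul_mul_tmul, one_mul,
          mul_one]
        abel }

/-- The counit of `U(h)`, which kills the elements of `h`. -/
def counitAlgHom : UniversalEnvelopingAlgebra k h →ₐ[k] k :=
  UniversalEnvelopingAlgebra.lift k (0 : h →ₗ⁅k⁆ k)

theorem comulAlgHom_ι (x : h) : comulAlgHom k h (UniversalEnvelopingAlgebra.ι k x) =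
    UniversalEnvelopingAlgebra.ι k x ⊗ₜ 1 + 1 ⊗ₜ UniversalEnvelopingAlgebra.ι k x := by
  rw [comulAlgHom, UniversalEnvelopingAlgebra.lift_ι_apply]; rfl

theorem counitAlgHom_ι (x : h) : counitAlgHom k h (UniversalEnvelopingAlgebra.ι k x) = 0 := by
  rw [counitAlgHom, UniversalEnvelopingAlgebra.lift_ι_apply]; rfl

instance : Bialgebra k (UniversalEnvelopingAlgebra k h) :=
  Bialgebra.ofAlgHom (comulAlgHom k h) (counitAlgHom k h)
    (UniversalEnvelopingAlgebra.hom_ext k (LieHom.ext fun x => by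
      change Algebra.TensorProduct.assoc k k k _ _ _ (Algebra.TensorProduct.map (comulAlgHom k h)
        (.id k _) (comulAlgHom k h (UniversalEnvelopingAlgebra.ι k x))) =
        Algebra.TensorProduct.map (.id k _) (comulAlgHom k h)
          (comulAlgHom k h (UniversalEnvelopingAlgebra.ι k x))
      simp only [comulAlgHom_ι, map_add, Algebra.TensorProduct.map_tmul, AlgHom.id_apply, map_one,
        Algebra.TensorProduct.one_def, TensorProduct.add_tmul, TensorProduct.tmul_add,
        Algebra.TensorProduct.assoc_tmul]
      abel))
    (UniversalEnvelopingAlgebra.hom_ext k (LieHom.ext fun x => by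
      change Algebra.TensorProduct.map (counitAlgHom k h) (.id k _)
        (comulAlgHom k h (UniversalEnvelopingAlgebra.ι k x)) =
        1 ⊗ₜ UniversalEnvelopingAlgebra.ι k x
      simp [-UniversalEnvelopingAlgebra.ι_apply, comulAlgHom_ι, counitAlgHom_ι]))
    (UniversalEnvelopingAlgebra.hom_ext k (LieHom.ext fun x => by
      change Algebra.TensorProduct.map (.id k _) (counitAlgHom k h)
        (comulAlgHom k h (UniversalEnvelopingAlgebra.ι k x)) =
        UniversalEnvelopingAlgebra.ι k x ⊗ₜ 1
      simp [-UniversalEnvelopingAlgebra.ι_apply, comulAlgHom_ι, counitAlgHom_ι]))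

end LieEnvelope

/-! ### The Hopf superalgebra structure of the exterior algebra -/

namespace ExteriorSuper

variable (k V : Type*) [CommRing k] [AddCommGroup V] [Module k V]

/-- The `ZMod 2`-grading of the exterior algebra, for which the elements of `V` are odd. -/
abbrev gr : ZMod 2 → Submodule k (ExteriorAlgebra k V) :=
  CliffordAlgebra.evenOdd (0 : QuadraticForm k V)

theorem ι_mem (v : V) : ExteriorAlgebra.ι k v ∈ gr k V 1 := CliffordAlgebra.ι_mem_evenOdd_one _ v

/-- The map `v ↦ v ⊗ 1 + 1 ⊗ v`. -/
def primitive : V →ₗ[k] gr k V ᵍ⊗[k] gr k V :=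
  ((GradedTensorProduct.includeLeft (gr k V) (gr k V)).toLinearMap +
    (GradedTensorProduct.includeRight (gr k V) (gr k V)).toLinearMap) ∘ₗ ExteriorAlgebra.ι k

/-- The coproduct of `⋀ V`: the superalgebra map for which the elements of `V` are primitive. -/
def comulAlgHom : ExteriorAlgebra k V →ₐ[k] gr k V ᵍ⊗[k] gr k V :=
  ExteriorAlgebra.lift k ⟨primitive k V, fun v => by
    have h := SuperAux.prim_mul_prim (gr k V) (ι_mem k V v) (ι_mem k V v)
    simp only [ExteriorAlgebra.ι_sq_zero] at h
    refine h.trans ?_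
    simp only [mul_one, uzpow_one, Units.neg_smul, one_smul, add_neg_cancel_right]
    exact (congrArg₂ (· + ·) (map_zero (GradedTensorProduct.includeLeft (gr k V) (gr k V)))
      (map_zero (GradedTensorProduct.includeRight (gr k V) (gr k V)))).trans (add_zero 0)⟩

/-- The counit of `⋀ V`, which kills the elements of `V`. -/
def counitAlgHom : ExteriorAlgebra k V →ₐ[k] k := ExteriorAlgebra.lift k ⟨0, by simp⟩

theorem adjoin_prims :
    Algebra.adjoin k (SuperAux.prims (comulAlgHom k V) (counitAlgHom k V)) = ⊤ := by
  rw [eq_top_iff, ← CliffordAlgebra.adjoin_range_ι, Algebra.adjoin_le_iff]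
  rintro _ ⟨v, rfl⟩
  refine Algebra.subset_adjoin ⟨1, ι_mem k V v, ?_, ?_⟩
  · exact ExteriorAlgebra.lift_ι_apply k _ _ v
  · exact ExteriorAlgebra.lift_ι_apply k _ _ v

instance : Coalgebra k (ExteriorAlgebra k V) :=
  SuperAux.coalgebra (comulAlgHom k V) (counitAlgHom k V) (adjoin_prims k V)

end ExteriorSuper

/-! ### The module structures over `U(g₀)`, and the tensor product of supermodules -/

/-- The grading of the tensor product of two supermodules. -/
def superTensorGr {k V W : Type*} [CommRing k] [AddCommGroup V] [Module k V] [AddCommGroup W]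
    [Module k W] (𝒱 : ZMod 2 → Submodule k V) (𝒲 : ZMod 2 → Submodule k W) (i : ZMod 2) :
    Submodule k (V ⊗[k] W) :=
  ⨆ j : ZMod 2, LinearMap.range (TensorProduct.mapIncl (𝒱 j) (𝒲 (i - j)))

/-- The grading of a purely even supermodule. -/
def purelyEven (k V : Type*) [CommRing k] [AddCommGroup V] [Module k V] (i : ZMod 2) :
    Submodule k V :=
  if i = 0 then ⊤ else ⊥

namespace LieSuperalgebra

variable {k g : Type*} [CommRing k] [AddCommGroup g] [Module k g] (L : LieSuperalgebra k g)

/-- The enveloping algebra `U(g₀)` of the even part. -/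
abbrev EvenEnvelope : Type _ := UniversalEnvelopingAlgebra k (L.gr 0)

section

attribute [local instance 100] LieRing.ofAssociativeRing

/-- The algebra map `U(g₀) → 𝐔(g)` induced by the inclusion of `g₀` into `g`. -/
def evenMap : L.EvenEnvelope →ₐ[k] L.Envelope :=
  UniversalEnvelopingAlgebra.lift k
    { L.ι ∘ₗ (L.gr 0).subtype with
      map_lie' := fun {x y} => by
        simpa [LieRing.of_associative_ring_bracket] using (L.ι_comm x.2 y.2).symm }

theorem evenMap_ι (x : L.gr 0) : L.evenMap (UniversalEnvelopingAlgebra.ι k x) = L.ι (x : g) := by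
  rw [evenMap, UniversalEnvelopingAlgebra.lift_ι_apply]; rfl

end

/-- `𝐔(g)` as a left `U(g₀)`-module. -/
instance : Module L.EvenEnvelope L.Envelope := Module.compHom L.Envelope L.evenMap.toRingHom

/-- `𝐔(g)` as a right `U(g₀)`-module. -/
instance : Module (L.EvenEnvelope)ᵐᵒᵖ L.Envelope :=
  Module.compHom L.Envelope L.evenMap.toRingHom.op

theorem even_smul_def (a : L.EvenEnvelope) (x : L.Envelope) : a • x = L.evenMap a * x := rfl

theorem even_op_smul_def (a : L.EvenEnvelope) (x : L.Envelope) :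
    MulOpposite.op a • x = x * L.evenMap a := rfl

/-- The product `x₁ ⋯ xₙ` in `𝐔(g)` of the elements `x₁ < ⋯ < xₙ` of a finite set `s` of indices
of a totally ordered family `b` of odd elements. -/
def orderedProd {X : Type*} [LinearOrder X] (b : X → L.gr 1) (s : Finset X) : L.Envelope :=
  ((s.sort (· ≤ ·)).map fun x => L.ι (b x : g)).prod

end LieSuperalgebra

end

set_option linter.unusedSectionVars false

noncomputable section

/-! ### Lie superalgebras in terms of their even and odd components -/

/-! Spanning is easy: the relations `xy = [x, y] - yx`, `x² = ½[x, x]` and `ux = xu + [u, x]` sort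
any product into ordered odd monomials with a coefficient from `U(g₀)` on one side. The content is
independence, and it is obtained by building a module on which the independence is visible, in the
manner of the classical proof of Poincaré–Birkhoff–Witt. No structure theorem for `U(g₀)` is needed,
because the even part enters only through a representation.

Since 2 is a non-zero-divisor on `k` and both components are flat, they have no 2-torsion. Hence
`½[v, v]` is a well-defined quadratic map on `g₁`, and every identity it must satisfy follows by
doubling it. `SuperPair` records exactly the identities that the construction uses.

Given a representation `N` of `g₀` and an ordered basis `X` of `g₁`, the space `Finset X →₀ N` of
formal sums of ordered monomials with coefficients in `N` receives operators by recursion on the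
length of the monomial: the rewriting rules above, read as definitions. The leading term of an odd
operator is exterior multiplication (`lead`), and the correction (`lower`) is shorter
(`entry_mem_fil`). Induction on length then proves the relations (`single_insert_mem_good`,
`mem_good`); the critical overlaps are resolved by the Jacobi identities and their halved forms.

For `N = U(g₀)` the induced module maps to `𝐔(g)` by evaluating monomials (`fromInduced`), and
acting on the empty monomial with coefficient 1 gives the inverse. This yields the basis for right
scalars (`right_basis`). For left scalars the same construction is run for the opposite brackets and
the dual order (`left_basis`).

For part (2), the ordered products in `⋀ g₁` and in `𝐔(g)` are matched. Their coproducts are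
computed by the same formula, because multiplying by a primitive below all variables that occur
never invokes a relation (`comul_ofExterior_basis`). Multiplication by the coalgebra map `U(g₀) →
𝐔(g)` then gives the isomorphism. -/

/-- The structure maps of a Lie superalgebra with even component `G` and odd component `V`,
together with the quadratic map `v ↦ ½[v, v]`. -/
structure SuperPair (k G V : Type*) [CommRing k] [AddCommGroup G] [Module k G]
    [AddCommGroup V] [Module k V] where
  /-- the bracket of two even elements -/
  lie : G →ₗ[k] G →ₗ[k] G
  /-- the bracket of an even and an odd element -/
  act : G →ₗ[k] V →ₗ[k] V
  /-- the bracket of two odd elements -/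
  pair : V →ₗ[k] V →ₗ[k] G
  /-- half the bracket of an odd element with itself -/
  half : V → G
  lie_skew : ∀ u w, lie u w = -lie w u
  act_lie : ∀ u w x, act (lie u w) x = act u (act w x) - act w (act u x)
  pair_symm : ∀ x y, pair x y = pair y x
  lie_pair : ∀ u x y, lie u (pair x y) = pair (act u x) y + pair x (act u y)
  act_pair : ∀ x y z, act (pair x y) z + act (pair y z) x + act (pair z x) y = 0
  lie_half : ∀ u x, lie u (half x) = pair (act u x) x
  act_half_self : ∀ x, act (half x) x = 0
  act_half : ∀ x y, act (half x) y + act (pair x y) x = 0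
  half_add : ∀ x y, half (x + y) = half x + half y + pair x y
  half_smul : ∀ (c : k) x, half (c • x) = (c * c) • half x

namespace SuperPair

variable {k G V : Type*} [CommRing k] [AddCommGroup G] [Module k G]
    [AddCommGroup V] [Module k V]

/-- The opposite structure, for which `[x, y]` is replaced by `[y, x]`. -/
def op (D : SuperPair k G V) : SuperPair k G V where
  lie := D.lie.flip
  act := -D.act
  pair := D.pair
  half := D.half
  lie_skew u w := by simp [D.lie_skew w u]
  act_lie u w x := by simp [D.act_lie w u]
  pair_symm := D.pair_symm
  lie_pair u x y := by
    simp only [LinearMap.flip_apply, LinearMap.neg_apply, map_neg]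
    rw [D.lie_skew, D.lie_pair]; abel
  act_pair x y z := by
    simp only [LinearMap.neg_apply]
    rw [← neg_add, ← neg_add, D.act_pair, neg_zero]
  lie_half u x := by
    simp only [LinearMap.flip_apply, LinearMap.neg_apply, map_neg]
    rw [D.lie_skew, D.lie_half]
  act_half_self x := by simp [D.act_half_self]
  act_half x y := by
    simp only [LinearMap.neg_apply]
    rw [← neg_add, D.act_half, neg_zero]
  half_add := D.half_add
  half_smul := D.half_smul

/-- A representation of a Lie superalgebra given by its even and odd components. -/
structure Rep (D : SuperPair k G V) (Q : Type*) [AddCommGroup Q] [Module k Q] where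
  /-- the action of the even elements -/
  even : G →ₗ[k] Module.End k Q
  /-- the action of the odd elements -/
  odd : V →ₗ[k] Module.End k Q
  even_lie : ∀ u w m, even u (even w m) - even w (even u m) = even (D.lie u w) m
  even_odd : ∀ u x m, even u (odd x m) = odd x (even u m) + odd (D.act u x) m
  odd_odd : ∀ x y m, odd x (odd y m) + odd y (odd x m) = even (D.pair x y) m
  odd_sq : ∀ x m, odd x (odd x m) = even (D.half x) m

/-! ### Ordered monomials, their length filtration, and exterior multiplication. -/

section Induced

variable {X N : Type*} [AddCommGroup N] [Module k N]

/-- The span of the monomials of length less than `n`. -/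
def fil (k : Type*) (X N : Type*) [CommRing k] [AddCommGroup N] [Module k N] (n : ℕ) :
    Submodule k (Finset X →₀ N) :=
  Submodule.span k {m | ∃ S a, S.card < n ∧ m = Finsupp.single S a}

theorem single_mem_fil {n : ℕ} {S : Finset X} (h : S.card < n) (a : N) :
    Finsupp.single S a ∈ fil k X N n := Submodule.subset_span ⟨S, a, h, rfl⟩

theorem fil_mono {n m : ℕ} (h : n ≤ m) : fil k X N n ≤ fil k X N m :=
  Submodule.span_mono fun _ ⟨S, a, hS, e⟩ => ⟨S, a, hS.trans_le h, e⟩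

theorem mem_fil_of_single {Q : Type*} [AddCommGroup Q] [Module k Q] {n : ℕ}
    (f : (Finset X →₀ N) →ₗ[k] Q) (P : Submodule k Q)
    (h : ∀ S a, S.card < n → f (Finsupp.single S a) ∈ P) {m : Finset X →₀ N}
    (hm : m ∈ fil k X N n) : f m ∈ P := by
  have : fil k X N n ≤ P.comap f := by
    rw [fil, Submodule.span_le]
    rintro _ ⟨S, a, hS, rfl⟩
    exact h S a hS
  exact this hm

theorem eq_of_single {Q : Type*} [AddCommGroup Q] [Module k Q] {n : ℕ}
    (f g : (Finset X →₀ N) →ₗ[k] Q)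
    (h : ∀ S a, S.card < n → f (Finsupp.single S a) = g (Finsupp.single S a)) {m : Finset X →₀ N}
    (hm : m ∈ fil k X N n) : f m = g m := by
  have := mem_fil_of_single (f - g) ⊥ (fun S a hS => by simp [h S a hS]) hm
  simpa [sub_eq_zero] using this

theorem exists_mem_fil (m : Finset X →₀ N) : ∃ n, m ∈ fil k X N n := by
  induction m using Finsupp.induction_linear with
  | zero => exact ⟨0, zero_mem _⟩
  | single S a => exact ⟨S.card + 1, single_mem_fil (Nat.lt_succ_self _) a⟩
  | add x y hx hy =>
    obtain ⟨i, hi⟩ := hx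
    obtain ⟨j, hj⟩ := hy
    exact ⟨max i j, add_mem (fil_mono (le_max_left _ _) hi) (fil_mono (le_max_right _ _) hj)⟩

variable (D : SuperPair k G V) [LinearOrder X] (b : Module.Basis X k V)
  (ρ : G →ₗ[k] Module.End k N)

/-- The span of the monomials in the variables greater than `y`. -/
def above (k : Type*) {X : Type*} [LinearOrder X] (N : Type*) [CommRing k] [AddCommGroup N]
    [Module k N] (y : X) : Submodule k (Finset X →₀ N) :=
  Submodule.span k {m | ∃ S a, (∀ t ∈ S, y < t) ∧ m = Finsupp.single S a}

theorem eq_of_above {Q : Type*} [AddCommGroup Q] [Module k Q] {y : X}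
    (f g : (Finset X →₀ N) →ₗ[k] Q)
    (h : ∀ S a, (∀ t ∈ S, y < t) → f (Finsupp.single S a) = g (Finsupp.single S a))
    {m : Finset X →₀ N} (hm : m ∈ above k N y) : f m = g m := by
  have : above k N y ≤ LinearMap.ker (f - g) := by
    rw [above, Submodule.span_le]
    rintro _ ⟨S, a, hS, rfl⟩
    simp [h S a hS]
  simpa [sub_eq_zero] using this hm

variable (k N) in
/-- Left multiplication by a variable in the exterior algebra. -/
def lead (x : X) : (Finset X →₀ N) →ₗ[k] (Finset X →₀ N) :=
  -- The sign counts the smaller variables that `x` passes on the way to its sorted place.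
  Finsupp.lsum k fun S => if x ∈ S then 0 else
    (-1 : k) ^ (S.filter (· < x)).card • Finsupp.lsingle (insert x S)

theorem lead_single (x : X) (S : Finset X) (a : N) :
    lead k N x (Finsupp.single S a) = if x ∈ S then 0 else
      (-1 : k) ^ (S.filter (· < x)).card • Finsupp.single (insert x S) a := by
  rw [lead, Finsupp.lsum_single]
  split <;> simp

theorem lead_of_lt {x : X} {S : Finset X} (h : ∀ t ∈ S, x < t) (a : N) :
    lead k N x (Finsupp.single S a) = Finsupp.single (insert x S) a := by
  have h1 : x ∉ S := fun hx => lt_irrefl _ (h x hx)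
  have h2 : S.filter (· < x) = ∅ := Finset.filter_eq_empty_iff.2 fun t ht => (h t ht).asymm
  rw [lead_single, if_neg h1, h2]
  simp

theorem lead_self (y : X) (T : Finset X) (a : N) :
    lead k N y (Finsupp.single (insert y T) a) = 0 := by
  rw [lead_single, if_pos (Finset.mem_insert_self _ _)]

/-- On `above k N y` the operator of `y` is plain insertion, so its relations hold there by
construction; this lemma puts leading terms into that range. -/
theorem lead_mem_above {x y : X} (hxy : y < x) {T : Finset X} (h : ∀ t ∈ T, y < t) (a : N) :
    lead k N x (Finsupp.single T a) ∈ above k N y := by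
  rw [lead_single]
  split
  · exact zero_mem _
  · refine Submodule.smul_mem _ _ (Submodule.subset_span ⟨_, a, ?_, rfl⟩)
    intro t ht
    rcases Finset.mem_insert.1 ht with rfl | ht
    exacts [hxy, h t ht]

/-- The variable `y` is one more element for `x` to pass, hence one more sign. Thus the leading part
of `xy = [x, y] - yx` is already accounted for by `lead`, and the recursion has to supply the lower
part only. -/
theorem lead_insert {x y : X} (hxy : y < x) {T : Finset X} (h : ∀ t ∈ T, y < t) (a : N) :
    lead k N x (Finsupp.single (insert y T) a) =
      -lead k N y (lead k N x (Finsupp.single T a)) := by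
  have hy : y ∉ T := fun hx => lt_irrefl _ (h y hx)
  by_cases hx : x ∈ T
  · rw [lead_single, lead_single, if_pos hx, if_pos (Finset.mem_insert_of_mem hx), map_zero,
      neg_zero]
  · have hx' : x ∉ insert y T := by simp [hxy.ne', hx]
    rw [lead_single, lead_single, if_neg hx, if_neg hx', map_smul, lead_of_lt,
      Finset.filter_insert, if_pos hxy, Finset.card_insert_of_notMem (by simp [hy]),
      Finset.insert_comm, pow_succ]
    · simp
    · intro t ht
      rcases Finset.mem_insert.1 ht with rfl | ht
      exacts [hxy, h t ht]

theorem lead_mem_fil (x : X) {n : ℕ} {m : Finset X →₀ N} (hm : m ∈ fil k X N n) :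
    lead k N x m ∈ fil k X N (n + 1) := by
  refine mem_fil_of_single _ _ (fun S a hS => ?_) hm
  rw [lead_single]
  split
  · exact zero_mem _
  · exact Submodule.smul_mem _ _
      (single_mem_fil ((Finset.card_insert_le _ _).trans_lt (by omega)) a)

/-! ### Recursive construction of the even and odd operators. -/

variable (k G X N) in
/-- The values, on the monomials with a given set of variables, of the lower order terms of the
odd operators and of the even operators. -/
abbrev Entry : Type _ :=
  (X → N →ₗ[k] (Finset X →₀ N)) × (G →ₗ[k] N →ₗ[k] (Finset X →₀ N))

/-- The lower order term of the odd operator attached to a variable. -/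
def lower (F : Finset X → Entry k G X N) (x : X) : (Finset X →₀ N) →ₗ[k] (Finset X →₀ N) :=
  Finsupp.lsum k fun S => (F S).1 x

/-- The odd operator attached to a variable. -/
def oddVar (F : Finset X → Entry k G X N) (x : X) : (Finset X →₀ N) →ₗ[k] (Finset X →₀ N) :=
  lead k N x + lower F x

/-- The odd operators. -/
def oddOp (F : Finset X → Entry k G X N) : V →ₗ[k] Module.End k (Finset X →₀ N) :=
  b.constr k (oddVar F)

/-- The even operators. -/
def evenOp (F : Finset X → Entry k G X N) : G →ₗ[k] Module.End k (Finset X →₀ N) :=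
  (Finsupp.lsum k fun S => (F S).2.flip).flip

theorem lower_single (F : Finset X → Entry k G X N) (x : X) (S : Finset X) (a : N) :
    lower F x (Finsupp.single S a) = (F S).1 x a := by
  rw [lower, Finsupp.lsum_single]

theorem evenOp_single (F : Finset X → Entry k G X N) (u : G) (S : Finset X) (a : N) :
    evenOp F u (Finsupp.single S a) = (F S).2 u a := by
  rw [evenOp, LinearMap.flip_apply, Finsupp.lsum_single, LinearMap.flip_apply]

theorem oddOp_basis (F : Finset X → Entry k G X N) (x : X) : oddOp b F (b x) = oddVar F x :=
  b.constr_basis k _ x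

/-- One step of the recursive definition of the operators. -/
def step (F : Finset X → Entry k G X N) (S : Finset X) : Entry k G X N :=
  if h : S.Nonempty then
    (fun x =>
      -- The three cases, with `y` the least element of `S` and `T` the rest: `x y T` is already
      -- sorted; `y y T = ½[y, y] T`; and `x y T = [x, y] T - y (x T)`, where only the lower part of
      -- `x T` contributes to the lower part.
      if x < S.min' h then 0
      else if x = S.min' h then evenOp F (D.half (b x)) ∘ₗ Finsupp.lsingle (S.erase (S.min' h))
      else (evenOp F (D.pair (b x) (b (S.min' h))) - oddVar F (S.min' h) ∘ₗ lower F x) ∘ₗ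
        Finsupp.lsingle (S.erase (S.min' h)),
    -- The rule `u y T = y (u T) + [u, y] T`.
    (LinearMap.lcomp k _ (Finsupp.lsingle (S.erase (S.min' h)))) ∘ₗ
      ((LinearMap.llcomp k _ _ _ (oddVar F (S.min' h))) ∘ₗ evenOp F +
        oddOp b F ∘ₗ D.act.flip (b (S.min' h))))
  else (0, (LinearMap.llcomp k _ _ _ (Finsupp.lsingle ∅)) ∘ₗ ρ)

/-- The truncation of a family of entries. -/
def trunc (F : Finset X → Entry k G X N) (n : ℕ) (S : Finset X) : Entry k G X N :=
  if S.card < n then F S else 0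

/-- The entries that define the operators on the induced representation. -/
def entry : Finset X → Entry k G X N :=
  WellFounded.fix (measure Finset.card).wf fun S rec =>
    -- The default value 0 is harmless: by `entry_mem_fil`, the operators in `step` are only
    -- evaluated on combinations of monomials shorter than `S`.
    step D b ρ (fun T => if h : T.card < S.card then rec T h else 0) S

theorem entry_eq (S : Finset X) :
    entry D b ρ S = step D b ρ (trunc (entry D b ρ) S.card) S := by
  rw [entry, WellFounded.fix_eq]
  rfl

/-- Together with its analogues for the other operators, this removes the truncation from the
recursive equations once the length bounds are known. -/
theorem lower_trunc (F : Finset X → Entry k G X N) (x : X) {n : ℕ} {m : Finset X →₀ N}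
    (hm : m ∈ fil k X N n) : lower (trunc F n) x m = lower F x m := by
  refine eq_of_single _ _ (fun S a hS => ?_) hm
  rw [lower_single, lower_single, trunc, if_pos hS]

theorem oddVar_trunc (F : Finset X → Entry k G X N) (x : X) {n : ℕ} {m : Finset X →₀ N}
    (hm : m ∈ fil k X N n) : oddVar (trunc F n) x m = oddVar F x m := by
  rw [oddVar, oddVar, LinearMap.add_apply, LinearMap.add_apply, lower_trunc F x hm]

theorem evenOp_trunc (F : Finset X → Entry k G X N) (u : G) {n : ℕ} {m : Finset X →₀ N}
    (hm : m ∈ fil k X N n) : evenOp (trunc F n) u m = evenOp F u m := by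
  refine eq_of_single _ _ (fun S a hS => ?_) hm
  rw [evenOp_single, evenOp_single, trunc, if_pos hS]

theorem eq_of_basis {Q : Type*} [AddCommGroup Q] [Module k Q] {f g : V →ₗ[k] Q}
    (h : ∀ x, f (b x) = g (b x)) (v : V) : f v = g v := by
  rw [b.ext h]

theorem oddOp_trunc (F : Finset X → Entry k G X N) (v : V) {n : ℕ} {m : Finset X →₀ N}
    (hm : m ∈ fil k X N n) : oddOp b (trunc F n) v m = oddOp b F v m := by
  refine eq_of_basis b (f := (oddOp b (trunc F n)).flip m) (g := (oddOp b F).flip m) ?_ v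
  intro x
  rw [LinearMap.flip_apply, LinearMap.flip_apply, oddOp_basis, oddOp_basis, oddVar_trunc F x hm]

theorem lower_of_lt {x : X} {S : Finset X} (h : ∀ t ∈ S, x < t) (a : N) :
    lower (entry D b ρ) x (Finsupp.single S a) = 0 := by
  rw [lower_single, entry_eq, step]
  split_ifs with hS
  · simp only [if_pos (h _ (S.min'_mem hS)), LinearMap.zero_apply]
  · rfl

theorem min'_insert_of_lt {y : X} {T : Finset X} (h : ∀ t ∈ T, y < t) :
    (insert y T).min' (Finset.insert_nonempty y T) = y := by
  refine le_antisymm (Finset.min'_le _ _ (Finset.mem_insert_self _ _)) (Finset.le_min' _ _ _ ?_)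
  intro t ht
  rcases Finset.mem_insert.1 ht with rfl | ht
  exacts [le_rfl, (h t ht).le]

theorem entry_insert {y : X} {T : Finset X} (h : ∀ t ∈ T, y < t) :
    let F := trunc (entry D b ρ) (T.card + 1)
    (∀ a, (entry D b ρ (insert y T)).1 y a =
      evenOp F (D.half (b y)) (Finsupp.single T a)) ∧
    (∀ x, y < x → ∀ a, (entry D b ρ (insert y T)).1 x a =
      evenOp F (D.pair (b x) (b y)) (Finsupp.single T a) -
        oddVar F y (lower F x (Finsupp.single T a))) ∧
    ∀ u a, (entry D b ρ (insert y T)).2 u a =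
      oddVar F y (evenOp F u (Finsupp.single T a)) +
        oddOp b F (D.act u (b y)) (Finsupp.single T a) := by
  have hy : y ∉ T := fun hx => lt_irrefl _ (h y hx)
  have he : (insert y T).erase y = T := Finset.erase_insert hy
  rw [entry_eq, Finset.card_insert_of_notMem hy, step, dif_pos (Finset.insert_nonempty y T)]
  simp only [min'_insert_of_lt h, he]
  refine ⟨fun a => ?_, fun x hx a => ?_, fun u a => rfl⟩
  · rw [if_neg (lt_irrefl y), if_pos trivial]; rfl
  · rw [if_neg hx.asymm, if_neg hx.ne']; rfl

theorem exists_insert_of_nonempty {S : Finset X} (hS : S.Nonempty) :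
    ∃ y T, S = insert y T ∧ (∀ t ∈ T, y < t) ∧ S.card = T.card + 1 := by
  refine ⟨S.min' hS, S.erase (S.min' hS), (Finset.insert_erase (S.min'_mem hS)).symm, ?_,
    (Finset.card_erase_add_one (S.min'_mem hS)).symm⟩
  intro t ht
  exact lt_of_le_of_ne (S.min'_le _ (Finset.mem_of_mem_erase ht)) (Finset.ne_of_mem_erase ht).symm

theorem evenOp_empty (u : G) (a : N) :
    evenOp (entry D b ρ) u (Finsupp.single ∅ a) = Finsupp.single ∅ (ρ u a) := by
  rw [evenOp_single, entry_eq, step, dif_neg Finset.not_nonempty_empty]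
  rfl

/-- Induction on length through the recursive formulas: even operators do not lengthen a monomial,
and the correction to an odd operator is strictly shorter than its leading term. In `[x, y] T - y ·
lower x T` the second term is safe because `lower` has shortened `T` before `y` lengthens it again.
-/
theorem entry_mem_fil (S : Finset X) :
    (∀ x a, lower (entry D b ρ) x (Finsupp.single S a) ∈ fil k X N S.card) ∧
    ∀ u a, evenOp (entry D b ρ) u (Finsupp.single S a) ∈ fil k X N (S.card + 1) := by
  induction hn : S.card using Nat.strong_induction_on generalizing S with
  | h n ih =>
  subst hn
  rcases S.eq_empty_or_nonempty with rfl | hS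
  · refine ⟨fun x a => ?_, fun u a => ?_⟩
    · rw [lower_of_lt]
      exacts [zero_mem _, by simp]
    · rw [evenOp_empty]
      exact single_mem_fil (Nat.lt_succ_self _) _
  · obtain ⟨y, T, rfl, hT, hc⟩ := exists_insert_of_nonempty hS
    rw [hc] at ih ⊢
    have low : ∀ x {j} {m : Finset X →₀ N}, j ≤ T.card → m ∈ fil k X N (j + 1) →
        lower (entry D b ρ) x m ∈ fil k X N j := by
      intro x j m hj hm
      refine mem_fil_of_single _ _ (fun R a hR => ?_) hm
      exact fil_mono (by omega) ((ih R.card (by omega) R rfl).1 x a)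
    have ev : ∀ u {j} {m : Finset X →₀ N}, j ≤ T.card + 1 → m ∈ fil k X N j →
        evenOp (entry D b ρ) u m ∈ fil k X N j := by
      intro u j m hj hm
      refine mem_fil_of_single _ _ (fun R a hR => ?_) hm
      exact fil_mono (by omega) ((ih R.card (by omega) R rfl).2 u a)
    have od : ∀ x {j} {m : Finset X →₀ N}, j ≤ T.card + 1 → m ∈ fil k X N j →
        oddVar (entry D b ρ) x m ∈ fil k X N (j + 1) := by
      intro x j m hj hm
      refine add_mem (lead_mem_fil x hm) ?_
      refine mem_fil_of_single _ _ (fun R a hR => ?_) hm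
      exact fil_mono (by omega) ((ih R.card (by omega) R rfl).1 x a)
    have sT : ∀ a : N, (Finsupp.single T a : Finset X →₀ N) ∈ fil k X N (T.card + 1) :=
      fun a => single_mem_fil (Nat.lt_succ_self _) a
    obtain ⟨e1, e2, e3⟩ := entry_insert D b ρ hT
    refine ⟨fun x a => ?_, fun u a => ?_⟩
    · rcases lt_trichotomy x y with hx | rfl | hx
      · rw [lower_of_lt]
        · exact zero_mem _
        · intro t ht
          rcases Finset.mem_insert.1 ht with rfl | ht
          exacts [hx, hx.trans (hT t ht)]
      · rw [lower_single, e1, evenOp_trunc _ _ (sT a)]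
        exact ev _ le_rfl (sT a)
      · have h1 := low x le_rfl (sT a)
        rw [lower_single, e2 x hx, evenOp_trunc _ _ (sT a), lower_trunc _ _ (sT a),
          oddVar_trunc _ _ (fil_mono (Nat.le_succ _) h1)]
        exact sub_mem (ev _ le_rfl (sT a)) (od _ (Nat.le_succ _) h1)
    · have h1 := ev u le_rfl (sT a)
      rw [evenOp_single, e3, evenOp_trunc _ _ (sT a), oddVar_trunc _ _ h1, oddOp_trunc _ _ _ (sT a)]
      refine add_mem (od _ le_rfl h1) ?_
      generalize D.act u (b y) = v
      have : (⊤ : Submodule k V) ≤ (fil k X N (T.card + 1 + 1)).comap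
          ((oddOp b (entry D b ρ)).flip (Finsupp.single T a)) := by
        rw [← b.span_eq, Submodule.span_le]
        rintro _ ⟨x, rfl⟩
        change oddOp b (entry D b ρ) (b x) (Finsupp.single T a) ∈ fil k X N (T.card + 1 + 1)
        rw [oddOp_basis]
        exact od x le_rfl (sT a)
      exact this (Submodule.mem_top (x := v))

end Induced

end SuperPair

end

noncomputable section

namespace SuperPair

variable {k G V : Type*} [CommRing k] [AddCommGroup G] [Module k G]
    [AddCommGroup V] [Module k V]

@[elab_as_elim]
theorem basis_induction {X : Type*} (b : Module.Basis X k V) {p : V → Prop} (zero : p 0)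
    (add : ∀ v w, p v → p w → p (v + w)) (smul : ∀ (c : k) v, p v → p (c • v))
    (basis : ∀ x, p (b x)) (v : V) : p v := by
  have hv : v ∈ Submodule.span k (Set.range b) := b.span_eq ▸ Submodule.mem_top
  induction hv using Submodule.span_induction with
  | mem _ h => obtain ⟨x, rfl⟩ := h; exact basis x
  | zero => exact zero
  | add v w _ _ hv hw => exact add v w hv hw
  | smul c v _ hv => exact smul c v hv

/-! ### The operators satisfy the relations of a representation. -/

section Induced

variable (D : SuperPair k G V) {X N : Type*} [LinearOrder X] [AddCommGroup N] [Module k N]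
  (b : Module.Basis X k V) (ρ : G →ₗ[k] Module.End k N)

/-- The odd operators of the induced representation. -/
def ind₁ : V →ₗ[k] Module.End k (Finset X →₀ N) := oddOp b (entry D b ρ)

/-- The even operators of the induced representation. -/
def ind₀ : G →ₗ[k] Module.End k (Finset X →₀ N) := evenOp (entry D b ρ)

theorem ind₁_basis (x : X) (m : Finset X →₀ N) :
    ind₁ D b ρ (b x) m = lead k N x m + lower (entry D b ρ) x m := by
  rw [ind₁, oddOp_basis]; rfl

theorem ind₀_mem_fil (u : G) {n : ℕ} {m : Finset X →₀ N} (hm : m ∈ fil k X N n) :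
    ind₀ D b ρ u m ∈ fil k X N n :=
  mem_fil_of_single _ _ (fun S a hS => fil_mono hS ((entry_mem_fil D b ρ S).2 u a)) hm

theorem ind₁_of_lt {x : X} {S : Finset X} (h : ∀ t ∈ S, x < t) (a : N) :
    ind₁ D b ρ (b x) (Finsupp.single S a) = Finsupp.single (insert x S) a := by
  rw [ind₁_basis, lower_of_lt D b ρ h, add_zero, lead_of_lt h]

theorem ind₁_of_above {y : X} {m : Finset X →₀ N} (hm : m ∈ above k N y) :
    ind₁ D b ρ (b y) m = lead k N y m := by
  refine eq_of_above _ _ (fun S a hS => ?_) hm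
  rw [ind₁_of_lt D b ρ hS, lead_of_lt hS]

theorem ind₀_insert (u : G) {y : X} {T : Finset X} (h : ∀ t ∈ T, y < t) (a : N) :
    ind₀ D b ρ u (Finsupp.single (insert y T) a) =
      ind₁ D b ρ (b y) (ind₀ D b ρ u (Finsupp.single T a)) +
        ind₁ D b ρ (D.act u (b y)) (Finsupp.single T a) := by
  have sT := single_mem_fil (k := k) (Nat.lt_succ_self T.card) a
  have h1 := ind₀_mem_fil D b ρ u sT
  simp only [ind₀] at h1
  rw [ind₀, ind₁, evenOp_single, (entry_insert D b ρ h).2.2, evenOp_trunc _ _ sT,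
    oddVar_trunc _ _ h1, oddOp_trunc _ _ _ sT, oddOp_basis]

theorem ind₁_insert_self {y : X} {T : Finset X} (h : ∀ t ∈ T, y < t) (a : N) :
    ind₁ D b ρ (b y) (Finsupp.single (insert y T) a) =
      ind₀ D b ρ (D.half (b y)) (Finsupp.single T a) := by
  have sT := single_mem_fil (k := k) (Nat.lt_succ_self T.card) a
  rw [ind₁_basis, lead_self, zero_add, lower_single, (entry_insert D b ρ h).1,
    evenOp_trunc _ _ sT, ind₀]

/-- The leading part `-lead y (lead x T)` and the term `-y · lower x T` recombine to `-y (x T)`,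
because `y` acts on `lead x T` by `lead y`. -/
theorem ind₁_insert {x y : X} (hxy : y < x) {T : Finset X} (h : ∀ t ∈ T, y < t) (a : N) :
    ind₁ D b ρ (b x) (Finsupp.single (insert y T) a) =
      ind₀ D b ρ (D.pair (b x) (b y)) (Finsupp.single T a) -
        ind₁ D b ρ (b y) (ind₁ D b ρ (b x) (Finsupp.single T a)) := by
  have sT := single_mem_fil (k := k) (Nat.lt_succ_self T.card) a
  rw [ind₁_basis, lead_insert hxy h, lower_single, (entry_insert D b ρ h).2.1 x hxy,
    evenOp_trunc _ _ sT, lower_trunc _ _ sT,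
    oddVar_trunc _ _ (fil_mono (Nat.le_succ _) ((entry_mem_fil D b ρ T).1 x a)), ← ind₀,
    ind₁_basis D b ρ x, map_add, ind₁_of_above D b ρ (lead_mem_above hxy h a), ind₁, oddOp_basis]
  abel

/-- The vectors at which the defining relations of a representation hold. -/
def good : Submodule k (Finset X →₀ N) where
  carrier := {m | (∀ u w, ind₀ D b ρ u (ind₀ D b ρ w m) - ind₀ D b ρ w (ind₀ D b ρ u m) =
      ind₀ D b ρ (D.lie u w) m) ∧
    (∀ u x, ind₀ D b ρ u (ind₁ D b ρ x m) =
      ind₁ D b ρ x (ind₀ D b ρ u m) + ind₁ D b ρ (D.act u x) m) ∧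
    (∀ x y, ind₁ D b ρ x (ind₁ D b ρ y m) + ind₁ D b ρ y (ind₁ D b ρ x m) =
      ind₀ D b ρ (D.pair x y) m) ∧
    ∀ x, ind₁ D b ρ x (ind₁ D b ρ x m) = ind₀ D b ρ (D.half x) m}
  zero_mem' := by simp
  add_mem' := by
    rintro m m' ⟨h1, h2, h3, h4⟩ ⟨h1', h2', h3', h4'⟩
    refine ⟨fun u w => ?_, fun u x => ?_, fun x y => ?_, fun x => ?_⟩
    · simp only [map_add, ← h1, ← h1']; abel
    · simp only [map_add, h2, h2']; abel
    · simp only [map_add, ← h3, ← h3']; abel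
    · simp only [map_add, h4, h4']
  smul_mem' := by
    rintro c m ⟨h1, h2, h3, h4⟩
    refine ⟨fun u w => ?_, fun u x => ?_, fun x y => ?_, fun x => ?_⟩
    · simp only [map_smul, ← h1, smul_sub]
    · simp only [map_smul, h2, smul_add]
    · simp only [map_smul, ← h3, smul_add]
    · simp only [map_smul, h4]

/-- Compare the values of `half (v + v)` and `half (2 v) = 4 half v`; no division by 2 is involved.
-/
theorem pair_self (v : V) : D.pair v v = (2 : ℕ) • D.half v := by
  have h1 := D.half_add v v
  have h2 := D.half_smul 2 v
  rw [two_smul, h1] at h2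
  have : D.pair v v = (2 * 2 : k) • D.half v - (D.half v + D.half v) := by rw [← h2]; abel
  rw [this]
  module

/-- All relations but the last are linear in each odd argument. Their diagonal case follows from the
square relation through `pair_self`, and the case `x < y` from symmetry. The square relation passes
from basis vectors to sums because both sides are quadratic maps with the same polarization. -/
theorem mem_good_of_basis {m : Finset X →₀ N}
    (h1 : ∀ u w, ind₀ D b ρ u (ind₀ D b ρ w m) - ind₀ D b ρ w (ind₀ D b ρ u m) =
      ind₀ D b ρ (D.lie u w) m)
    (h2 : ∀ u x, ind₀ D b ρ u (ind₁ D b ρ (b x) m) =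
      ind₁ D b ρ (b x) (ind₀ D b ρ u m) + ind₁ D b ρ (D.act u (b x)) m)
    (h3 : ∀ x y, y < x → ind₁ D b ρ (b x) (ind₁ D b ρ (b y) m) +
      ind₁ D b ρ (b y) (ind₁ D b ρ (b x) m) = ind₀ D b ρ (D.pair (b x) (b y)) m)
    (h4 : ∀ x, ind₁ D b ρ (b x) (ind₁ D b ρ (b x) m) = ind₀ D b ρ (D.half (b x)) m) :
    m ∈ good D b ρ := by
  have h3' : ∀ x y, ind₁ D b ρ (b x) (ind₁ D b ρ (b y) m) +
      ind₁ D b ρ (b y) (ind₁ D b ρ (b x) m) = ind₀ D b ρ (D.pair (b x) (b y)) m := by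
    intro x y
    rcases lt_trichotomy x y with h | rfl | h
    · rw [add_comm, h3 y x h, D.pair_symm]
    · rw [h4, D.pair_self, map_nsmul, two_nsmul]; rfl
    · exact h3 x y h
  have h3'' : ∀ v w, ind₁ D b ρ v (ind₁ D b ρ w m) + ind₁ D b ρ w (ind₁ D b ρ v m) =
      ind₀ D b ρ (D.pair v w) m := by
    intro v w
    induction v using basis_induction b with
    | zero => simp
    | add v v' hv hv' =>
      simp only [map_add, LinearMap.add_apply] at hv hv' ⊢
      rw [← hv, ← hv']; abel
    | smul c v hv =>
      simp only [map_smul, LinearMap.smul_apply] at hv ⊢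
      rw [← hv, smul_add]
    | basis x =>
      induction w using basis_induction b with
      | zero => simp
      | add v v' hv hv' =>
        simp only [map_add, LinearMap.add_apply] at hv hv' ⊢
        rw [← hv, ← hv']; abel
      | smul c v hv =>
        simp only [map_smul, LinearMap.smul_apply] at hv ⊢
        rw [← hv, smul_add]
      | basis y => exact h3' x y
  refine ⟨h1, fun u v => ?_, h3'', fun v => ?_⟩
  · induction v using basis_induction b with
    | zero => simp
    | add v v' hv hv' =>
      simp only [map_add, LinearMap.add_apply] at hv hv' ⊢
      rw [hv, hv']; abel
    | smul c v hv =>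
      simp only [map_smul, LinearMap.smul_apply] at hv ⊢
      rw [hv, smul_add]
    | basis x => exact h2 u x
  · induction v using basis_induction b with
    | zero =>
      have := D.half_smul 0 0
      simp only [zero_smul, mul_zero] at this
      simp [this]
    | add v v' hv hv' =>
      have := h3'' v v'
      simp only [D.half_add, map_add, LinearMap.add_apply] at hv hv' ⊢
      rw [← hv, ← hv', ← this]; abel
    | smul c v hv =>
      simp only [map_smul, LinearMap.smul_apply, D.half_smul] at hv ⊢
      rw [← hv, smul_smul]
    | basis x => exact h4 x

/-- On monomials above `y`, the relations that move an operator past `y` are the recursive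
definitions themselves. This lemma and the next two extend them linearly. -/
theorem ind₀_above (u : G) {y : X} {m : Finset X →₀ N} (hm : m ∈ above k N y) :
    ind₀ D b ρ u (ind₁ D b ρ (b y) m) =
      ind₁ D b ρ (b y) (ind₀ D b ρ u m) + ind₁ D b ρ (D.act u (b y)) m := by
  refine eq_of_above (ind₀ D b ρ u ∘ₗ ind₁ D b ρ (b y))
    (ind₁ D b ρ (b y) ∘ₗ ind₀ D b ρ u + ind₁ D b ρ (D.act u (b y))) (fun S a hS => ?_) hm
  simp only [LinearMap.comp_apply, LinearMap.add_apply]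
  rw [ind₁_of_lt D b ρ hS, ind₀_insert D b ρ u hS]

theorem ind₁_above_self {y : X} {m : Finset X →₀ N} (hm : m ∈ above k N y) :
    ind₁ D b ρ (b y) (ind₁ D b ρ (b y) m) = ind₀ D b ρ (D.half (b y)) m := by
  refine eq_of_above (ind₁ D b ρ (b y) ∘ₗ ind₁ D b ρ (b y))
    (ind₀ D b ρ (D.half (b y))) (fun S a hS => ?_) hm
  simp only [LinearMap.comp_apply]
  rw [ind₁_of_lt D b ρ hS, ind₁_insert_self D b ρ hS]

theorem ind₁_above {x y : X} (hxy : y < x) {m : Finset X →₀ N} (hm : m ∈ above k N y) :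
    ind₁ D b ρ (b x) (ind₁ D b ρ (b y) m) =
      ind₀ D b ρ (D.pair (b x) (b y)) m - ind₁ D b ρ (b y) (ind₁ D b ρ (b x) m) := by
  refine eq_of_above (ind₁ D b ρ (b x) ∘ₗ ind₁ D b ρ (b y))
    (ind₀ D b ρ (D.pair (b x) (b y)) - ind₁ D b ρ (b y) ∘ₗ ind₁ D b ρ (b x))
    (fun S a hS => ?_) hm
  simp only [LinearMap.comp_apply, LinearMap.sub_apply]
  rw [ind₁_of_lt D b ρ hS, ind₁_insert D b ρ hxy hS]

theorem lt_of_mem_insert {x y : X} (hxy : x < y) {T : Finset X} (hT : ∀ t ∈ T, y < t) :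
    ∀ t ∈ insert y T, x < t := by
  intro t ht
  rcases Finset.mem_insert.1 ht with rfl | ht
  exacts [hxy, hxy.trans (hT t ht)]

/-- The inductive step. The monomial is `y s` with `s` the shorter monomial `T`. Each relation at `y
s` is proved by moving the operators past `y`, using relations at `s`, at `u s` and at `x s`. The
vector `x s` may be too long for the induction hypothesis; for `x > y` it is a leading term above
`y`, where the relations involving `y` hold by construction, plus a shorter remainder. -/
theorem single_insert_mem_good {y : X} {T : Finset X} (hT : ∀ t ∈ T, y < t)
    (ih : fil k X N (T.card + 1) ≤ good D b ρ) (a : N) :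
    Finsupp.single (insert y T) a ∈ good D b ρ := by
  have sT := single_mem_fil (k := k) (Nat.lt_succ_self T.card) a
  have e : Finsupp.single (insert y T) a = ind₁ D b ρ (b y) (Finsupp.single T a) :=
    (ind₁_of_lt D b ρ hT a).symm
  obtain ⟨g1, g2, g3, g4⟩ := ih sT
  have ge := fun u => ih (ind₀_mem_fil D b ρ u sT)
  have split : ∀ x, ∃ p ∈ fil k X N (T.card + 1), ind₁ D b ρ (b x) (Finsupp.single T a) =
      lead k N x (Finsupp.single T a) + p := fun x =>
    ⟨_, fil_mono (Nat.le_succ _) ((entry_mem_fil D b ρ T).1 x a), ind₁_basis D b ρ x _⟩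
  -- The three relations involving `y`, at the vector `x s`.
  have above₀ : ∀ u x, y < x → ind₀ D b ρ u (ind₁ D b ρ (b y)
      (ind₁ D b ρ (b x) (Finsupp.single T a))) =
      ind₁ D b ρ (b y) (ind₀ D b ρ u (ind₁ D b ρ (b x) (Finsupp.single T a))) +
        ind₁ D b ρ (D.act u (b y)) (ind₁ D b ρ (b x) (Finsupp.single T a)) := by
    intro u x hx
    obtain ⟨p, hp, e⟩ := split x
    rw [e]
    simp only [map_add]
    rw [ind₀_above D b ρ u (lead_mem_above hx hT a), (ih hp).2.1]
    abel
  have aboveSelf : ∀ x, y < x → ind₁ D b ρ (b y) (ind₁ D b ρ (b y)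
      (ind₁ D b ρ (b x) (Finsupp.single T a))) =
      ind₀ D b ρ (D.half (b y)) (ind₁ D b ρ (b x) (Finsupp.single T a)) := by
    intro x hx
    obtain ⟨p, hp, e⟩ := split x
    rw [e]
    simp only [map_add]
    rw [ind₁_above_self D b ρ (lead_mem_above hx hT a), (ih hp).2.2.2]
  have above₁ : ∀ x z, y < x → y < z → ind₁ D b ρ (b x) (ind₁ D b ρ (b y)
      (ind₁ D b ρ (b z) (Finsupp.single T a))) =
      ind₀ D b ρ (D.pair (b x) (b y)) (ind₁ D b ρ (b z) (Finsupp.single T a)) -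
        ind₁ D b ρ (b y) (ind₁ D b ρ (b x) (ind₁ D b ρ (b z) (Finsupp.single T a))) := by
    intro x z hx hz
    obtain ⟨p, hp, e⟩ := split z
    rw [e]
    simp only [map_add]
    rw [ind₁_above D b ρ hx (lead_mem_above hz hT a), eq_sub_of_add_eq ((ih hp).2.2.1 _ _)]
    abel
  have low : ∀ x, x < y → Finsupp.single (insert y T) a ∈ above k N x := fun x hx =>
    Submodule.subset_span ⟨_, a, lt_of_mem_insert hx hT, rfl⟩
  rw [e] at low ⊢
  clear split e
  -- From here on only the recorded relations matter, not the form of `s`.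
  generalize (Finsupp.single T a : Finset X →₀ N) = s at *
  have swap : ∀ x, ind₁ D b ρ (b x) (ind₁ D b ρ (b y) s) =
      ind₀ D b ρ (D.pair (b x) (b y)) s - ind₁ D b ρ (b y) (ind₁ D b ρ (b x) s) :=
    fun x => eq_sub_of_add_eq (g3 _ _)
  refine mem_good_of_basis D b ρ (fun u w => ?_) (fun u x => ?_) (fun x z hxz => ?_) (fun x => ?_)
  · rw [g2 w, g2 u, map_add, map_add, (ge w).2.1, (ge u).2.1, g2 u (D.act w (b y)),
      g2 w (D.act u (b y)), g2 (D.lie u w), ← g1 u w, D.act_lie, map_sub, map_sub,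
      LinearMap.sub_apply]
    abel
  -- Below `y` the relation is a definition. At `y` it reduces to `[u, ½[y, y]] = [[u, y], y]`, and
  -- above `y` to the derivation property of `u` on `[x, y]`.
  · rcases lt_trichotomy x y with hx | rfl | hx
    · exact ind₀_above D b ρ u (low x hx)
    · rw [g4, g2 u, map_add, (ge u).2.2.2, eq_add_of_sub_eq (g1 u (D.half (b x))), D.lie_half,
        ← g3]
      abel
    · have h := (ge u).2.2.1 (b x) (b y)
      rw [swap, map_sub, above₀ u x hx, g2 u, g2 u, map_add, map_add, eq_sub_of_add_eq h,
        eq_add_of_sub_eq (g1 u (D.pair (b x) (b y))), D.lie_pair, map_add, LinearMap.add_apply,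
        ← g3, ← g3]
      abel
  -- Here `z < x`. The case `z = y` rests on `[½[y, y], x] + [[y, x], y] = 0`, and the case `y < z`
  -- on the Jacobi identity of `x`, `z`, `y`.
  · rcases lt_trichotomy z y with hz | rfl | hz
    · rw [ind₁_above D b ρ hxz (low z hz)]
      abel
    · have h := eq_neg_of_add_eq_zero_left (D.act_half (b z) (b x))
      rw [D.pair_symm] at h
      rw [g4, swap, map_sub, aboveSelf x hxz, g2, g2, h, map_neg, LinearMap.neg_apply]
      abel
    · have hx := hz.trans hxz
      have h := congrArg (ind₁ D b ρ (b y)) (g3 (b x) (b z))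
      rw [map_add] at h
      have h' := congrArg (fun v => ind₁ D b ρ v s) (D.act_pair (b x) (b z) (b y))
      simp only [map_add, LinearMap.add_apply, map_zero, LinearMap.zero_apply] at h'
      rw [swap, swap, map_sub, map_sub, above₁ x z hx hz, above₁ z x hz hx, g2, g2, g2, ← h,
        eq_neg_of_add_eq_zero_left ((add_assoc _ _ _).symm.trans h'), D.pair_symm (b y) (b x)]
      abel
  -- For the squares, `x = y` needs `[½[y, y], y] = 0`, and `x > y` needs `[½[x, x], y] + [[x, y],
  -- x] = 0`.
  · rcases lt_trichotomy x y with hx | rfl | hx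
    · exact ind₁_above_self D b ρ (low x hx)
    · rw [g4, g2, D.act_half_self, map_zero, LinearMap.zero_apply, add_zero]
    · rw [swap, map_sub, above₁ x x hx hx, g4, g2, g2,
        eq_neg_of_add_eq_zero_left (D.act_half (b x) (b y)), map_neg, LinearMap.neg_apply]
      abel

theorem fil_le_good (hρ : ∀ u w m, ρ u (ρ w m) - ρ w (ρ u m) = ρ (D.lie u w) m) (n : ℕ) :
    fil k X N n ≤ good D b ρ := by
  induction n with
  | zero =>
    rw [fil, Submodule.span_le]
    rintro _ ⟨S, a, hS, -⟩
    exact absurd hS (Nat.not_lt_zero _)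
  | succ n ih =>
    rw [fil, Submodule.span_le]
    rintro _ ⟨S, a, hS, rfl⟩
    rcases S.eq_empty_or_nonempty with rfl | hne
    -- The empty monomial is above every variable, so each relation with an odd operator holds by
    -- construction; only the even one uses that `N` is a representation.
    · have low : ∀ x : X, (Finsupp.single ∅ a : Finset X →₀ N) ∈ above k N x := fun x =>
        Submodule.subset_span ⟨∅, a, by simp, rfl⟩
      refine mem_good_of_basis D b ρ (fun u w => ?_) (fun u x => ?_) (fun x z hxz => ?_)
        (fun x => ?_)
      · simp only [ind₀, evenOp_empty, ← hρ, Finsupp.single_sub]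
      · exact ind₀_above D b ρ u (low x)
      · rw [ind₁_above D b ρ hxz (low z)]
        abel
      · exact ind₁_above_self D b ρ (low x)
    · obtain ⟨y, T, rfl, hT, hc⟩ := exists_insert_of_nonempty hne
      exact single_insert_mem_good D b ρ hT ((fil_mono (by omega)).trans ih) a

theorem mem_good (hρ : ∀ u w m, ρ u (ρ w m) - ρ w (ρ u m) = ρ (D.lie u w) m)
    (m : Finset X →₀ N) : m ∈ good D b ρ := by
  obtain ⟨n, hn⟩ := exists_mem_fil (k := k) m
  exact fil_le_good D b ρ hρ n hn

/-- The representation induced from a representation of the even component. -/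
def induced (hρ : ∀ u w m, ρ u (ρ w m) - ρ w (ρ u m) = ρ (D.lie u w) m) :
    D.Rep (Finset X →₀ N) where
  even := ind₀ D b ρ
  odd := ind₁ D b ρ
  even_lie u w m := (mem_good D b ρ hρ m).1 u w
  even_odd u x m := (mem_good D b ρ hρ m).2.1 u x
  odd_odd x y m := (mem_good D b ρ hρ m).2.2.1 x y
  odd_sq x m := (mem_good D b ρ hρ m).2.2.2 x

/-! ### Maps out of the induced representation. -/

variable {D} {Q : Type*} [AddCommGroup Q] [Module k Q] (R : D.Rep Q) (f : N →ₗ[k] Q)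

/-- The map out of the induced representation attached to a map of representations of the even
component. -/
def fromInduced : (Finset X →₀ N) →ₗ[k] Q :=
  Finsupp.lsum k fun S => ((S.sort (· ≤ ·)).map fun x => R.odd (b x)).prod ∘ₗ f

theorem fromInduced_single (S : Finset X) (a : N) : fromInduced b R f (Finsupp.single S a) =
    ((S.sort (· ≤ ·)).map fun x => R.odd (b x)).prod (f a) := by
  rw [fromInduced, Finsupp.lsum_single]; rfl

theorem fromInduced_insert {y : X} {T : Finset X} (hT : ∀ t ∈ T, y < t) (a : N) :
    fromInduced b R f (Finsupp.single (insert y T) a) =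
      R.odd (b y) (fromInduced b R f (Finsupp.single T a)) := by
  rw [fromInduced_single, fromInduced_single, Finset.sort_insert _ (fun t ht => (hT t ht).le)
    (fun h => lt_irrefl _ (hT y h))]
  rfl

theorem fromInduced_lead {y : X} {m : Finset X →₀ N} (hm : m ∈ above k N y) :
    fromInduced b R f (lead k N y m) = R.odd (b y) (fromInduced b R f m) := by
  refine eq_of_above (fromInduced b R f ∘ₗ lead k N y) (R.odd (b y) ∘ₗ fromInduced b R f)
    (fun S a hS => ?_) hm
  simp only [LinearMap.comp_apply]
  rw [lead_of_lt hS, fromInduced_insert b R f hS]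

/-- The recursive definition of the operators uses only rules that hold in every representation, so
evaluation of monomials commutes with them, by induction on length. -/
theorem fromInduced_fil (hf : ∀ u a, f (ρ u a) = R.even u (f a)) (n : ℕ) :
    ∀ m ∈ fil k X N n,
      (∀ u, fromInduced b R f (ind₀ D b ρ u m) = R.even u (fromInduced b R f m)) ∧
      ∀ v, fromInduced b R f (ind₁ D b ρ v m) = R.odd v (fromInduced b R f m) := by
  induction n with
  | zero =>
    intro m hm
    have : m = 0 := by
      have h : fil k X N 0 ≤ ⊥ := by
        rw [fil, Submodule.span_le]
        rintro _ ⟨S, a, hS, -⟩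
        exact absurd hS (Nat.not_lt_zero _)
      simpa using h hm
    simp [this]
  | succ n ih =>
    suffices h : ∀ (S : Finset X) (a : N), S.card < n + 1 →
        (∀ u, fromInduced b R f (ind₀ D b ρ u (Finsupp.single S a)) =
          R.even u (fromInduced b R f (Finsupp.single S a))) ∧
        ∀ x, fromInduced b R f (ind₁ D b ρ (b x) (Finsupp.single S a)) =
          R.odd (b x) (fromInduced b R f (Finsupp.single S a)) by
      intro m hm
      refine ⟨fun u => eq_of_single (fromInduced b R f ∘ₗ ind₀ D b ρ u)
        (R.even u ∘ₗ fromInduced b R f) (fun S a hS => (h S a hS).1 u) hm, fun v => ?_⟩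
      induction v using basis_induction b with
      | zero => simp
      | add v w hv hw => simp only [map_add, LinearMap.add_apply, hv, hw]
      | smul c v hv => simp only [map_smul, LinearMap.smul_apply, hv]
      | basis x =>
        exact eq_of_single (fromInduced b R f ∘ₗ ind₁ D b ρ (b x))
          (R.odd (b x) ∘ₗ fromInduced b R f) (fun S a hS => (h S a hS).2 x) hm
    intro S a hS
    rcases S.eq_empty_or_nonempty with rfl | hne
    · refine ⟨fun u => ?_, fun x => ?_⟩
      · rw [ind₀, evenOp_empty, fromInduced_single, fromInduced_single]
        simpa using hf u a
      · rw [ind₁_of_lt _ _ _ (by simp), fromInduced_insert _ _ _ (by simp)]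
    · obtain ⟨y, T, rfl, hT, hc⟩ := exists_insert_of_nonempty hne
      have sT := single_mem_fil (k := k) (by omega : T.card < n) a
      obtain ⟨i0, i1⟩ := ih _ sT
      refine ⟨fun u => ?_, fun x => ?_⟩
      · rw [ind₀_insert _ _ _ _ hT, map_add, (ih _ (ind₀_mem_fil D b ρ u sT)).2, i0, i1,
          fromInduced_insert b R f hT, R.even_odd]
      · rcases lt_trichotomy x y with hx | rfl | hx
        · rw [ind₁_of_lt _ _ _ (lt_of_mem_insert hx hT),
            fromInduced_insert _ _ _ (lt_of_mem_insert hx hT)]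
        · rw [ind₁_insert_self _ _ _ hT, i0, fromInduced_insert b R f hT, R.odd_sq]
        -- Again `x T` may be too long for the induction hypothesis; its leading term is above `y`
        -- and is treated by `fromInduced_lead`.
        · have key : fromInduced b R f (ind₁ D b ρ (b y) (ind₁ D b ρ (b x) (Finsupp.single T a))) =
              R.odd (b y) (fromInduced b R f (ind₁ D b ρ (b x) (Finsupp.single T a))) := by
            have hl := fil_mono (show T.card ≤ n by omega) ((entry_mem_fil D b ρ T).1 x a)
            rw [ind₁_basis D b ρ x, map_add, map_add, map_add, map_add,
              ind₁_of_above _ _ _ (lead_mem_above hx hT a),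
              fromInduced_lead b R f (lead_mem_above hx hT a), (ih _ hl).2]
          rw [ind₁_insert _ _ _ hx hT, map_sub, key, i0, i1, fromInduced_insert b R f hT,
            ← R.odd_odd]
          abel

theorem fromInduced_even (hf : ∀ u a, f (ρ u a) = R.even u (f a)) (u : G) (m : Finset X →₀ N) :
    fromInduced b R f (ind₀ D b ρ u m) = R.even u (fromInduced b R f m) := by
  obtain ⟨n, hn⟩ := exists_mem_fil (k := k) m
  exact (fromInduced_fil b ρ R f hf n m hn).1 u

theorem fromInduced_odd (hf : ∀ u a, f (ρ u a) = R.even u (f a)) (v : V) (m : Finset X →₀ N) :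
    fromInduced b R f (ind₁ D b ρ v m) = R.odd v (fromInduced b R f m) := by
  obtain ⟨n, hn⟩ := exists_mem_fil (k := k) m
  exact (fromInduced_fil b ρ R f hf n m hn).2 v

/-- Each factor is smaller than those already applied, so every step is a bare insertion. This is
what recovers a monomial from the corresponding element of the envelope, hence independence. -/
theorem prod_ind₁_empty (S : Finset X) (a : N) :
    ((S.sort (· ≤ ·)).map fun x => ind₁ D b ρ (b x)).prod (Finsupp.single ∅ a) =
      Finsupp.single S a := by
  induction hn : S.card generalizing S with
  | zero => simp [Finset.card_eq_zero.1 hn]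
  | succ n ih =>
    obtain ⟨y, T, rfl, hT, hc⟩ := exists_insert_of_nonempty (S := S) (Finset.card_pos.1 (by omega))
    rw [Finset.sort_insert _ (fun t ht => (hT t ht).le) (fun h => lt_irrefl _ (hT y h)),
      List.map_cons, List.prod_cons, Module.End.mul_apply, ih T (by omega), ind₁_of_lt _ _ _ hT]

end Induced

end SuperPair

end

noncomputable section

/-! ### The components of an admissible Lie superalgebra -/

/-- Tensoring the injection `c : k → k` with the flat module `M` gives multiplication by `c` on `M`.
-/
theorem Module.Flat.eq_zero_of_smul_eq_zero {k M : Type*} [CommRing k] [AddCommGroup M]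
    [Module k M] [Module.Flat k M] {c : k} (hc : ∀ a : k, c * a = 0 → a = 0) {m : M}
    (hm : c • m = 0) : m = 0 := by
  have inj : Function.Injective (LinearMap.mulLeft k c) :=
    (injective_iff_map_eq_zero _).2 hc
  have h := Module.Flat.rTensor_preserves_injective_linearMap (M := M) _ inj
  have h1 : (1 : k) ⊗ₜ[k] m = 0 := by
    apply h
    rw [LinearMap.rTensor_tmul, map_zero, LinearMap.mulLeft_apply, mul_one,
      ← mul_one c, ← smul_eq_mul, TensorProduct.smul_tmul, hm, TensorProduct.tmul_zero]
  simpa using congrArg (TensorProduct.lid k M) h1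

theorem ZMod.eq_zero_or_one : ∀ i : ZMod 2, i = 0 ∨ i = 1 := by decide

namespace LieSuperalgebra

variable {k g : Type*} [CommRing k] [AddCommGroup g] [Module k g] (L : LieSuperalgebra k g)

/-- The restriction of the bracket to homogeneous components. -/
def bracketOn {i j l : ZMod 2} (h : i + j = l) : L.gr i →ₗ[k] L.gr j →ₗ[k] L.gr l :=
  LinearMap.mk₂ k (fun x y => ⟨L.bracket x y, h ▸ L.bracket_mem x.2 y.2⟩)
    (fun _ _ _ => by ext; simp) (fun _ _ _ => by ext; simp) (fun _ _ _ => by ext; simp)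
    (fun _ _ _ => by ext; simp)

@[simp] theorem coe_bracketOn {i j l : ZMod 2} (h : i + j = l) (x : L.gr i) (y : L.gr j) :
    (L.bracketOn h x y : g) = L.bracket x y := rfl

theorem bracket_skew_even {i : ZMod 2} {z w : g} (hz : z ∈ L.gr 0) (hw : w ∈ L.gr i) :
    L.bracket z w = -L.bracket w z := by
  simpa [add_eq_zero_iff_eq_neg] using L.super_skew hz hw

theorem bracket_symm_odd {z w : g} (hz : z ∈ L.gr 1) (hw : w ∈ L.gr 1) :
    L.bracket z w = L.bracket w z := by
  simpa [Units.smul_def, add_neg_eq_zero] using L.super_skew hz hw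

theorem bracket_bracket_even {i : ZMod 2} {u w x : g} (hu : u ∈ L.gr 0) (hw : w ∈ L.gr 0)
    (hx : x ∈ L.gr i) : L.bracket (L.bracket u w) x =
      L.bracket u (L.bracket w x) - L.bracket w (L.bracket u x) := by
  have h := L.super_jacobi hu hw hx
  have h1 := L.bracket_skew_even hu (L.bracket_mem hw hx)
  have h2 := L.bracket_skew_even hw (L.bracket_mem hu hx)
  rw [L.bracket_skew_even hu hx, map_neg, map_neg, LinearMap.neg_apply, neg_inj] at h2
  simp only [zero_mul, add_zero, uzpow_zero, one_smul] at h
  rw [h1, L.bracket_skew_even hu hx, map_neg, h2, sub_neg_eq_add, ← sub_eq_zero, ← h]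
  abel

theorem even_bracket_odd_odd {u x y : g} (hu : u ∈ L.gr 0) (hx : x ∈ L.gr 1) (hy : y ∈ L.gr 1) :
    L.bracket u (L.bracket x y) = L.bracket (L.bracket u x) y + L.bracket x (L.bracket u y) := by
  have h := L.super_jacobi hu hx hy
  have h1 := L.bracket_skew_even hu (L.bracket_mem hx hy)
  have hyu : L.bracket y u ∈ L.gr 1 := by simpa using L.bracket_mem hy hu
  have h2 := L.bracket_symm_odd hyu hx
  simp only [zero_mul, zero_add, mul_one, uzpow_zero, uzpow_one, one_smul, Units.neg_smul, h2] at h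
  rw [h1, L.bracket_skew_even hu hy, map_neg, ← sub_eq_zero, ← neg_eq_zero, ← h]
  abel

theorem jacobi_odd {x y z : g} (hx : x ∈ L.gr 1) (hy : y ∈ L.gr 1) (hz : z ∈ L.gr 1) :
    L.bracket (L.bracket x y) z + L.bracket (L.bracket y z) x + L.bracket (L.bracket z x) y = 0 := by
  have h := L.super_jacobi hx hy hz
  have e : (1 + 1 : ZMod 2) = 0 := rfl
  simpa only [e, mul_zero, zero_mul, uzpow_zero, one_smul] using h

variable {L}

/-- Makes `½[v, v]` unique, and allows each identity for it to be checked after doubling, where it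
becomes an identity of the bracket. -/
theorem eq_of_two_nsmul {i : ZMod 2} (h2 : ∀ a : k, 2 * a = 0 → a = 0) (hL : L.Admissible)
    {x y : L.gr i} (h : (2 : ℕ) • x = (2 : ℕ) • y) : x = y := by
  have hf : Module.Flat k (L.gr i) := by
    rcases ZMod.eq_zero_or_one i with rfl | rfl
    · exact hL.flat_even
    · have := hL.free_odd
      infer_instance
  rw [← sub_eq_zero]
  apply Module.Flat.eq_zero_of_smul_eq_zero h2
  rw [smul_sub, sub_eq_zero, two_smul, two_smul, ← two_nsmul, ← two_nsmul, h]

/-- Half the bracket of an odd element with itself. -/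
def half (hL : L.Admissible) (v : L.gr 1) : L.gr 0 :=
  ⟨(hL.two_dvd v v.2).choose, (hL.two_dvd v v.2).choose_spec.1⟩

theorem two_nsmul_half (hL : L.Admissible) (v : L.gr 1) :
    (2 : ℕ) • half hL v = L.bracketOn rfl v v :=
  Subtype.ext (hL.two_dvd v v.2).choose_spec.2.symm

/-- The components of an admissible Lie superalgebra. -/
def toPair (h2 : ∀ a : k, 2 * a = 0 → a = 0) (hL : L.Admissible) :
    SuperPair k (L.gr 0) (L.gr 1) where
  lie := L.bracketOn (add_zero 0)
  act := L.bracketOn (zero_add 1)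
  pair := L.bracketOn rfl
  half := half hL
  lie_skew u w := Subtype.ext (L.bracket_skew_even u.2 w.2)
  act_lie u w x := Subtype.ext (L.bracket_bracket_even u.2 w.2 x.2)
  pair_symm x y := Subtype.ext (L.bracket_symm_odd x.2 y.2)
  lie_pair u x y := Subtype.ext (L.even_bracket_odd_odd u.2 x.2 y.2)
  act_pair x y z := Subtype.ext (L.jacobi_odd x.2 y.2 z.2)
  lie_half u x := by
    apply eq_of_two_nsmul h2 hL
    rw [← map_nsmul, two_nsmul_half]
    ext
    simp only [coe_bracketOn]
    rw [L.even_bracket_odd_odd u.2 x.2 x.2, L.bracket_symm_odd x.2 (by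
      simpa using L.bracket_mem u.2 x.2), two_nsmul]
    rfl
  act_half_self x := by
    apply eq_of_two_nsmul h2 hL
    rw [← LinearMap.smul_apply, ← map_nsmul, two_nsmul_half]
    ext
    simpa using L.bracket_odd_self x x.2
  act_half x y := by
    apply eq_of_two_nsmul h2 hL
    rw [smul_add, ← LinearMap.smul_apply, ← map_nsmul, two_nsmul_half, smul_zero]
    ext
    have h := L.jacobi_odd x.2 x.2 y.2
    rw [L.bracket_symm_odd y.2 x.2] at h
    simpa [two_nsmul, add_assoc] using h
  half_add x y := by
    apply eq_of_two_nsmul h2 hL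
    rw [smul_add, smul_add, two_nsmul_half, two_nsmul_half, two_nsmul_half]
    ext
    have := L.bracket_symm_odd x.2 y.2
    simp only [coe_bracketOn, Submodule.coe_add, map_add, LinearMap.add_apply, two_nsmul, this]
    abel
  half_smul c x := by
    apply eq_of_two_nsmul h2 hL
    rw [smul_comm, two_nsmul_half, two_nsmul_half]
    simp [mul_smul]

variable (L) in
/-- The projection to a homogeneous component. -/
def proj (i : ZMod 2) : g →ₗ[k] L.gr i :=
  letI := L.isInternal.chooseDecomposition
  DirectSum.component k (ZMod 2) (fun i => L.gr i) i ∘ₗ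
    (DirectSum.decomposeLinearEquiv L.gr).toLinearMap

theorem proj_coe {i : ZMod 2} (z : L.gr i) : L.proj i (z : g) = z := by
  let := L.isInternal.chooseDecomposition
  ext
  exact DirectSum.decompose_of_mem_same L.gr z.2

theorem proj_coe_of_ne {i j : ZMod 2} (h : j ≠ i) (z : L.gr j) : L.proj i (z : g) = 0 := by
  let := L.isInternal.chooseDecomposition
  ext
  exact DirectSum.decompose_of_mem_ne L.gr z.2 h

/-! ### Maps out of the envelope, given on the two components. -/

section lift

variable {B : Type*} [Ring B] [Algebra k B] (h2 : ∀ a : k, 2 * a = 0 → a = 0)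
  (hL : L.Admissible) (e : L.gr 0 →ₗ[k] B) (o : L.gr 1 →ₗ[k] B)

/-- The algebra map out of the universal envelope given by its values on the components. -/
def liftPair (he : ∀ u w, e u * e w - e w * e u = e ((toPair h2 hL).lie u w))
    (heo : ∀ u x, e u * o x - o x * e u = o ((toPair h2 hL).act u x))
    (ho : ∀ x y, o x * o y + o y * o x = e ((toPair h2 hL).pair x y))
    (hs : ∀ x, o x * o x = e ((toPair h2 hL).half x)) : L.Envelope →ₐ[k] B :=
  have f0 : ∀ {z} (hz : z ∈ L.gr 0), (e ∘ₗ L.proj 0 + o ∘ₗ L.proj 1) z = e ⟨z, hz⟩ := by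
    intro z hz
    lift z to L.gr 0 using hz
    simp [proj_coe, proj_coe_of_ne (show (0 : ZMod 2) ≠ 1 by decide)]
  have f1 : ∀ {z} (hz : z ∈ L.gr 1), (e ∘ₗ L.proj 0 + o ∘ₗ L.proj 1) z = o ⟨z, hz⟩ := by
    intro z hz
    lift z to L.gr 1 using hz
    simp [proj_coe, proj_coe_of_ne (show (1 : ZMod 2) ≠ 0 by decide)]
  L.lift (e ∘ₗ L.proj 0 + o ∘ₗ L.proj 1)
    (by
      intro i j z w hz hw
      have hi := ZMod.eq_zero_or_one i
      have hj := ZMod.eq_zero_or_one j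
      rcases hi with rfl | rfl <;> rcases hj with rfl | rfl
      · have hb : L.bracket z w ∈ L.gr 0 := by simpa using L.bracket_mem hz hw
        rw [f0 hz, f0 hw, f0 hb, mul_zero, uzpow_zero, one_smul]
        exact he ⟨z, hz⟩ ⟨w, hw⟩
      · have hb : L.bracket z w ∈ L.gr 1 := by simpa using L.bracket_mem hz hw
        rw [f0 hz, f1 hw, f1 hb, zero_mul, uzpow_zero, one_smul]
        exact heo ⟨z, hz⟩ ⟨w, hw⟩
      · have hb : L.bracket w z ∈ L.gr 1 := by simpa using L.bracket_mem hw hz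
        -- The odd-even relation is the negative of the even-odd one.
        rw [← neg_neg (L.bracket z w), ← L.bracket_skew_even hw hz, map_neg, f1 hz, f0 hw, f1 hb,
          mul_zero, uzpow_zero, one_smul, ← neg_sub]
        exact congrArg Neg.neg (heo ⟨w, hw⟩ ⟨z, hz⟩)
      · have hb : L.bracket z w ∈ L.gr 0 := L.bracket_mem hz hw
        rw [f1 hz, f1 hw, f0 hb, mul_one, uzpow_one, Units.neg_smul, one_smul, sub_neg_eq_add]
        exact ho ⟨z, hz⟩ ⟨w, hw⟩)
    (by
      intro v u hv hu h
      rw [f1 hv, f0 hu, hs]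
      congr 1
      -- The defining relation admits any `u` with `[v, v] = 2u`; absence of 2-torsion identifies it
      -- with the chosen half.
      apply eq_of_two_nsmul h2 hL
      refine (two_nsmul_half hL _).trans ?_
      ext
      exact h)

variable (he heo ho hs)

@[simp] theorem liftPair_even (u : L.gr 0) :
    liftPair h2 hL e o he heo ho hs (L.ι u) = e u := by
  simp [liftPair, proj_coe, proj_coe_of_ne (show (0 : ZMod 2) ≠ 1 by decide)]

@[simp] theorem liftPair_odd (x : L.gr 1) :
    liftPair h2 hL e o he heo ho hs (L.ι x) = o x := by
  simp [liftPair, proj_coe, proj_coe_of_ne (show (1 : ZMod 2) ≠ 0 by decide)]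

end lift

/-! ### The envelope as a representation, on the left and on the right. -/

section envelope

variable (L) (h2 : ∀ a : k, 2 * a = 0 → a = 0) (hL : L.Admissible)

theorem ι_even_even (u w : L.gr 0) :
    L.ι u * L.ι w - L.ι w * L.ι u = L.ι ((toPair h2 hL).lie u w : L.gr 0) := by
  have h := L.ι_comm u.2 w.2
  rwa [mul_zero, uzpow_zero, one_smul] at h

theorem ι_even_odd (u : L.gr 0) (x : L.gr 1) :
    L.ι u * L.ι x - L.ι x * L.ι u = L.ι ((toPair h2 hL).act u x : L.gr 1) := by
  have h := L.ι_comm u.2 x.2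
  rwa [zero_mul, uzpow_zero, one_smul] at h

theorem ι_odd_odd (x y : L.gr 1) :
    L.ι x * L.ι y + L.ι y * L.ι x = L.ι ((toPair h2 hL).pair x y : L.gr 0) := by
  have h := L.ι_comm x.2 y.2
  rwa [mul_one, uzpow_one, Units.neg_smul, one_smul, sub_neg_eq_add] at h

theorem ι_odd_sq (x : L.gr 1) :
    L.ι x * L.ι x = L.ι ((toPair h2 hL).half x : L.gr 0) :=
  L.ι_sq x.2 (half hL x).2 (congrArg Subtype.val (two_nsmul_half hL x)).symm

/-- The universal envelope as a representation by left multiplication. -/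
def leftRep : (toPair h2 hL).Rep L.Envelope where
  even := LinearMap.mul k L.Envelope ∘ₗ L.ι ∘ₗ (L.gr 0).subtype
  odd := LinearMap.mul k L.Envelope ∘ₗ L.ι ∘ₗ (L.gr 1).subtype
  even_lie u w m := by
    simp [← L.ι_even_even h2 hL, mul_assoc]
  even_odd u x m := by
    simp [← L.ι_even_odd h2 hL, mul_assoc]
  odd_odd x y m := by
    simp [← L.ι_odd_odd h2 hL, mul_assoc]
  odd_sq x m := by
    simp [← L.ι_odd_sq h2 hL, mul_assoc]

/-- The universal envelope as a representation of the opposite structure by right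
multiplication. -/
def rightRep : (toPair h2 hL).op.Rep L.Envelope where
  even := (LinearMap.mul k L.Envelope).flip ∘ₗ L.ι ∘ₗ (L.gr 0).subtype
  odd := (LinearMap.mul k L.Envelope).flip ∘ₗ L.ι ∘ₗ (L.gr 1).subtype
  even_lie u w m := by
    simp [SuperPair.op, ← L.ι_even_even h2 hL, mul_assoc]
  even_odd u x m := by
    simp [SuperPair.op, ← L.ι_even_odd h2 hL, mul_assoc]
  odd_odd x y m := by
    simp [SuperPair.op, ← L.ι_odd_odd h2 hL, mul_assoc, add_comm]
  odd_sq x m := by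
    simp [SuperPair.op, ← L.ι_odd_sq h2 hL, mul_assoc]

theorem adjoin_range_ι : Algebra.adjoin k (Set.range L.ι) = ⊤ := by
  have : Set.range L.ι = L.toEnvelope '' Set.range (TensorAlgebra.ι k) := by
    rw [← Set.range_comp]; rfl
  rw [this, ← AlgHom.map_adjoin, TensorAlgebra.adjoin_range_ι, Algebra.map_top,
    AlgHom.range_eq_top]
  exact L.toEnvelope_surjective

@[elab_as_elim]
theorem envelope_induction {p : L.Envelope → Prop} (algebraMap : ∀ c, p (algebraMap k _ c))
    (even : ∀ u : L.gr 0, p (L.ι u)) (odd : ∀ x : L.gr 1, p (L.ι x))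
    (add : ∀ x y, p x → p y → p (x + y)) (mul : ∀ x y, p x → p y → p (x * y))
    (x : L.Envelope) : p x := by
  have hx : x ∈ Algebra.adjoin k (Set.range L.ι) := L.adjoin_range_ι ▸ Algebra.mem_top
  induction hx using Algebra.adjoin_induction with
  | mem _ h =>
    obtain ⟨z, rfl⟩ := h
    induction z using L.homogeneous_induction with
    | h0 => simpa using algebraMap 0
    | @hm i z hz =>
      have hi := ZMod.eq_zero_or_one i
      rcases hi with rfl | rfl
      exacts [even ⟨z, hz⟩, odd ⟨z, hz⟩]
    | ha z w hz hw => rw [map_add]; exact add _ _ hz hw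
  | algebraMap c => exact algebraMap c
  | add x y _ _ hx hy => exact add x y hx hy
  | mul x y _ _ hx hy => exact mul x y hx hy

end envelope

end LieSuperalgebra

@[elab_as_elim]
theorem UniversalEnvelopingAlgebra.induction_on' {k h : Type*} [CommRing k] [LieRing h]
    [LieAlgebra k h] {p : UniversalEnvelopingAlgebra k h → Prop}
    (algebraMap : ∀ c, p (algebraMap k _ c)) (ι : ∀ u, p (UniversalEnvelopingAlgebra.ι k u))
    (add : ∀ x y, p x → p y → p (x + y)) (mul : ∀ x y, p x → p y → p (x * y))
    (x : UniversalEnvelopingAlgebra k h) : p x := by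
  obtain ⟨t, rfl⟩ := RingCon.mkₐ_surjective (α := k) (UniversalEnvelopingAlgebra.ringCon k h) x
  induction t using TensorAlgebra.induction with
  | algebraMap r => exact algebraMap r
  | ι u => exact ι u
  | mul x y hx hy => rw [map_mul]; exact mul _ _ hx hy
  | add x y hx hy => rw [map_add]; exact add _ _ hx hy

end

noncomputable section

/-! ### The bases of the universal envelope over the enveloping algebra of the even component -/

/-- Only an additive `Ψ` is asked for, with scalars entering through `t`. One statement thus covers
left scalars in `U(g₀)` and right scalars, where `t` identifies the opposite ring with `U(g₀)`
additively. -/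
theorem exists_basis_of_bijective {A U I W : Type*} [Ring A] [AddCommGroup U] [AddCommGroup W]
    [Module A W] (t : A ≃+ U) (v : I → W) (Ψ : (I →₀ U) →+ W) (hb : Function.Bijective Ψ)
    (h : ∀ i a, Ψ (Finsupp.single i (t a)) = a • v i) :
    ∃ B : Module.Basis I A W, ∀ i, B i = v i := by
  have key : ∀ l : I →₀ A, Finsupp.linearCombination A v l =
      Ψ (Finsupp.mapRange.addEquiv t l) := by
    intro l
    induction l using Finsupp.induction_linear with
    | zero => simp
    | add x y hx hy => rw [map_add, map_add, map_add, hx, hy]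
    | single i a => simp [h]
  have li : LinearIndependent A v := by
    rw [linearIndependent_iff]
    intro l hl
    rw [key, ← map_zero Ψ] at hl
    exact (Finsupp.mapRange.addEquiv t).map_eq_zero_iff.1 (hb.1 hl)
  have sp : ⊤ ≤ Submodule.span A (Set.range v) := by
    rintro w -
    obtain ⟨m, rfl⟩ := hb.2 w
    obtain ⟨l, rfl⟩ := (Finsupp.mapRange.addEquiv t).surjective m
    rw [← key, ← Finsupp.range_linearCombination]
    exact ⟨l, rfl⟩
  exact ⟨Module.Basis.mk li sp, fun i => Module.Basis.mk_apply li sp i⟩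

namespace LieSuperalgebra

variable {k g : Type*} [CommRing k] [AddCommGroup g] [Module k g] {L : LieSuperalgebra k g}

section evenι

attribute [local instance 100] LieRing.ofAssociativeRing

variable (L) in
/-- The canonical map from the even component to its enveloping algebra. -/
def evenι : L.gr 0 →ₗ[k] L.EvenEnvelope := (UniversalEnvelopingAlgebra.ι k : L.gr 0 →ₗ⁅k⁆ _)

theorem evenι_apply (u : L.gr 0) : L.evenι u = UniversalEnvelopingAlgebra.ι k u := rfl

theorem evenMap_evenι (u : L.gr 0) : L.evenMap (L.evenι u) = L.ι u := L.evenMap_ι u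

theorem evenι_mul_sub (u w : L.gr 0) : L.evenι u * L.evenι w - L.evenι w * L.evenι u =
    L.evenι (L.bracketOn (add_zero 0) u w) :=
  ((UniversalEnvelopingAlgebra.ι k : L.gr 0 →ₗ⁅k⁆ L.EvenEnvelope).map_lie u w).symm

end evenι

/-! ### From representations to modules over the envelope. -/

section homOfRep

variable (h2 : ∀ a : k, 2 * a = 0 → a = 0) (hL : L.Admissible) {Q : Type*} [AddCommGroup Q]
  [Module k Q]

/-- The action of the universal envelope attached to a representation. -/
def homOfRep (R : (toPair h2 hL).Rep Q) : L.Envelope →ₐ[k] Module.End k Q :=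
  liftPair h2 hL R.even R.odd (fun u w => LinearMap.ext (R.even_lie u w))
    (fun u x => LinearMap.ext fun m => sub_eq_iff_eq_add'.2 (R.even_odd u x m))
    (fun x y => LinearMap.ext (R.odd_odd x y)) (fun x => LinearMap.ext (R.odd_sq x))

theorem homOfRep_even (R : (toPair h2 hL).Rep Q) (u : L.gr 0) :
    homOfRep h2 hL R (L.ι u) = R.even u := liftPair_even ..

theorem homOfRep_odd (R : (toPair h2 hL).Rep Q) (x : L.gr 1) :
    homOfRep h2 hL R (L.ι x) = R.odd x := liftPair_odd ..

/-- The right action of the universal envelope attached to a representation of the opposite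
structure. -/
def homOfOpRep (R : (toPair h2 hL).op.Rep Q) : L.Envelope →ₐ[k] (Module.End k Q)ᵐᵒᵖ :=
  liftPair h2 hL ((MulOpposite.opLinearEquiv k).toLinearMap ∘ₗ R.even)
    ((MulOpposite.opLinearEquiv k).toLinearMap ∘ₗ R.odd)
    -- Passing to the opposite ring reverses products and `op` reverses the bracket, hence the
    -- exchange of `u` and `w`.
    (fun u w => congrArg MulOpposite.op (LinearMap.ext fun m => R.even_lie w u m))
    (fun u x => congrArg MulOpposite.op (LinearMap.ext fun m => by
      have h := R.even_odd u x m
      rw [show (toPair h2 hL).op.act u x = -(toPair h2 hL).act u x from rfl, map_neg,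
        LinearMap.neg_apply] at h
      change R.odd x (R.even u m) - R.even u (R.odd x m) = R.odd ((toPair h2 hL).act u x) m
      rw [h]
      abel))
    (fun x y => congrArg MulOpposite.op (LinearMap.ext fun m =>
      (add_comm _ _).trans (R.odd_odd x y m)))
    (fun x => congrArg MulOpposite.op (LinearMap.ext (R.odd_sq x)))

theorem homOfOpRep_even (R : (toPair h2 hL).op.Rep Q) (u : L.gr 0) :
    (homOfOpRep h2 hL R (L.ι u)).unop = R.even u :=
  congrArg MulOpposite.unop (liftPair_even ..)

theorem homOfOpRep_odd (R : (toPair h2 hL).op.Rep Q) (x : L.gr 1) :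
    (homOfOpRep h2 hL R (L.ι x)).unop = R.odd x :=
  congrArg MulOpposite.unop (liftPair_odd ..)

end homOfRep

/-- Induce from `U(g₀)` acting on itself by left multiplication. Evaluation `Ψ` sends the monomial
`s` with coefficient `a` to `x₁ ⋯ xₙ a`, so the coefficients stand on the right. Acting on the empty
monomial with coefficient 1 inverts `Ψ`. -/
theorem right_basis (h2 : ∀ a : k, 2 * a = 0 → a = 0) (hL : L.Admissible) {X : Type*}
    [LinearOrder X] (b : Module.Basis X k (L.gr 1)) : ∃ B : Module.Basis (Finset X) (L.EvenEnvelope)ᵐᵒᵖ L.Envelope,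
    ∀ s, B s = L.orderedProd b s := by
  let D := toPair h2 hL
  let ρ : L.gr 0 →ₗ[k] Module.End k L.EvenEnvelope := LinearMap.mul k _ ∘ₗ L.evenι
  have hρ : ∀ u w m, ρ u (ρ w m) - ρ w (ρ u m) = ρ (D.lie u w) m := fun u w m => by
    change L.evenι u * (L.evenι w * m) - L.evenι w * (L.evenι u * m) =
      L.evenι (L.bracketOn (add_zero 0) u w) * m
    rw [← evenι_mul_sub, sub_mul, mul_assoc, mul_assoc]
  let I := D.induced b ρ hρ
  let R := L.leftRep h2 hL
  let Ψ := SuperPair.fromInduced b R L.evenMap.toLinearMap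
  have hf : ∀ u a, L.evenMap.toLinearMap (ρ u a) = R.even u (L.evenMap.toLinearMap a) := by
    intro u a
    change L.evenMap (L.evenι u * a) = L.ι u * L.evenMap a
    rw [map_mul, evenMap_evenι]
  let Θ := homOfRep h2 hL I
  have Ψ_single : ∀ s a, Ψ (Finsupp.single s a) = L.orderedProd b s * L.evenMap a := by
    intro s a
    refine (SuperPair.fromInduced_single b R _ s a).trans ?_
    rw [orderedProd]
    generalize s.sort (· ≤ ·) = l
    induction l with
    | nil => simp
    | cons x l ih =>
      rw [List.map_cons, List.map_cons, List.prod_cons, List.prod_cons, Module.End.mul_apply, ih,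
        mul_assoc]
      rfl
  -- `Ψ` is linear over the envelope; surjectivity follows, since `Ψ` takes the empty monomial with
  -- coefficient 1 to 1.
  have ΨΘ : ∀ z m, Ψ (Θ z m) = z * Ψ m := by
    intro z
    induction z using L.envelope_induction with
    | algebraMap c => intro m; simp [Algebra.smul_def, Module.algebraMap_end_apply]
    | even u =>
      intro m
      rw [homOfRep_even]
      exact SuperPair.fromInduced_even b ρ R _ hf u m
    | odd x =>
      intro m
      rw [homOfRep_odd]
      exact SuperPair.fromInduced_odd b ρ R _ hf x m
    | add x y hx hy => intro m; rw [map_add, LinearMap.add_apply, map_add, hx, hy, add_mul]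
    | mul x y hx hy => intro m; rw [map_mul, Module.End.mul_apply, hx, hy, mul_assoc]
  have Θ_even : ∀ a c, Θ (L.evenMap a) (Finsupp.single ∅ c) = Finsupp.single ∅ (a * c) := by
    intro a
    induction a using UniversalEnvelopingAlgebra.induction_on' with
    | algebraMap r =>
      intro c
      simp [Algebra.smul_def, Module.algebraMap_end_apply]
    | ι u =>
      intro c
      rw [← evenι_apply, evenMap_evenι, homOfRep_even]
      exact SuperPair.evenOp_empty D b ρ u c
    | add x y hx hy =>
      intro c; rw [map_add, map_add, LinearMap.add_apply, hx, hy, add_mul, Finsupp.single_add]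
    | mul x y hx hy =>
      intro c; rw [map_mul, map_mul, Module.End.mul_apply, hy, hx, mul_assoc]
  -- Injectivity: `a` acts first and becomes the coefficient of the empty monomial, then the ordered
  -- odd product builds `s`.
  have ΘΨ : ∀ m, Θ (Ψ m) (Finsupp.single ∅ 1) = m := by
    intro m
    induction m using Finsupp.induction_linear with
    | zero => simp
    | add x y hx hy => rw [map_add, map_add, LinearMap.add_apply, hx, hy]
    | single s a =>
      rw [Ψ_single, map_mul, Module.End.mul_apply, Θ_even, mul_one, orderedProd, map_list_prod,
        List.map_map]
      refine Eq.trans ?_ (SuperPair.prod_ind₁_empty (D := D) b ρ s a)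
      congr 3
      funext x
      exact homOfRep_odd ..
  have bij : Function.Bijective Ψ := by
    refine ⟨fun m m' h => ?_, fun z => ⟨Θ z (Finsupp.single ∅ 1), ?_⟩⟩
    · rw [← ΘΨ m, ← ΘΨ m', h]
    · rw [ΨΘ, Ψ_single]
      simp [orderedProd]
  exact exists_basis_of_bijective (MulOpposite.opAddEquiv (α := L.EvenEnvelope)).symm
    (L.orderedProd b) Ψ.toAddMonoidHom
    bij fun s a => Ψ_single s a.unop

/-- The mirror image of `right_basis`: right multiplication is a representation of the opposite
structure. Coefficients now stand on the left, and successive right multiplications write the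
variables in decreasing order. -/
theorem left_basis_reverse (h2 : ∀ a : k, 2 * a = 0 → a = 0) (hL : L.Admissible) {X : Type*}
    [LinearOrder X] (b : Module.Basis X k (L.gr 1)) : ∃ B : Module.Basis (Finset X) L.EvenEnvelope L.Envelope,
    ∀ s, B s = ((s.sort (· ≤ ·)).reverse.map fun x => L.ι (b x : g)).prod := by
  let D := (toPair h2 hL).op
  let ρ : L.gr 0 →ₗ[k] Module.End k L.EvenEnvelope := (LinearMap.mul k _).flip ∘ₗ L.evenι
  have hρ : ∀ u w m, ρ u (ρ w m) - ρ w (ρ u m) = ρ (D.lie u w) m := fun u w m => by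
    change m * L.evenι w * L.evenι u - m * L.evenι u * L.evenι w =
      m * L.evenι (L.bracketOn (add_zero 0) w u)
    rw [← evenι_mul_sub, mul_sub, mul_assoc, mul_assoc]
  let I := D.induced b ρ hρ
  let R := L.rightRep h2 hL
  let Ψ := SuperPair.fromInduced b R L.evenMap.toLinearMap
  have hf : ∀ u a, L.evenMap.toLinearMap (ρ u a) = R.even u (L.evenMap.toLinearMap a) := by
    intro u a
    change L.evenMap (a * L.evenι u) = L.evenMap a * L.ι u
    rw [map_mul, evenMap_evenι]
  let Θ := homOfOpRep h2 hL I
  have Ψ_single : ∀ s a, Ψ (Finsupp.single s a) =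
      L.evenMap a * ((s.sort (· ≤ ·)).reverse.map fun x => L.ι (b x : g)).prod := by
    intro s a
    refine (SuperPair.fromInduced_single b R _ s a).trans ?_
    generalize s.sort (· ≤ ·) = l
    induction l with
    | nil => simp
    | cons x l ih =>
      rw [List.map_cons, List.prod_cons, Module.End.mul_apply, ih, List.reverse_cons,
        List.map_append, List.prod_append, ← mul_assoc]
      simp only [List.map_cons, List.map_nil, List.prod_cons, List.prod_nil, mul_one]
      rfl
  have ΨΘ : ∀ z m, Ψ ((Θ z).unop m) = Ψ m * z := by
    intro z
    induction z using L.envelope_induction with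
    | algebraMap c =>
      intro m
      rw [AlgHom.commutes, MulOpposite.algebraMap_apply, MulOpposite.unop_op,
        Module.algebraMap_end_apply, map_smul, Algebra.smul_def, Algebra.commutes]
    | even u =>
      intro m
      rw [homOfOpRep_even]
      exact SuperPair.fromInduced_even b ρ R _ hf u m
    | odd x =>
      intro m
      rw [homOfOpRep_odd]
      exact SuperPair.fromInduced_odd b ρ R _ hf x m
    | add x y hx hy =>
      intro m; rw [map_add, MulOpposite.unop_add, LinearMap.add_apply, map_add, hx, hy, mul_add]
    | mul x y hx hy =>
      intro m; rw [map_mul, MulOpposite.unop_mul, Module.End.mul_apply, hy, hx, mul_assoc]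
  have Θ_even : ∀ a c, (Θ (L.evenMap a)).unop (Finsupp.single ∅ c) =
      Finsupp.single ∅ (c * a) := by
    intro a
    induction a using UniversalEnvelopingAlgebra.induction_on' with
    | algebraMap r =>
      intro c
      rw [AlgHom.commutes, AlgHom.commutes, MulOpposite.algebraMap_apply, MulOpposite.unop_op,
        Module.algebraMap_end_apply, Finsupp.smul_single, Algebra.smul_def, Algebra.commutes]
    | ι u =>
      intro c
      rw [← evenι_apply, evenMap_evenι, homOfOpRep_even]
      exact SuperPair.evenOp_empty D b ρ u c
    | add x y hx hy =>
      intro c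
      rw [map_add, map_add, MulOpposite.unop_add, LinearMap.add_apply, hx, hy, mul_add,
        Finsupp.single_add]
    | mul x y hx hy =>
      intro c
      rw [map_mul, map_mul, MulOpposite.unop_mul, Module.End.mul_apply, hx, hy, mul_assoc]
  have ΘΨ : ∀ m, (Θ (Ψ m)).unop (Finsupp.single ∅ 1) = m := by
    intro m
    induction m using Finsupp.induction_linear with
    | zero => simp
    | add x y hx hy =>
      rw [map_add, map_add, MulOpposite.unop_add, LinearMap.add_apply, hx, hy]
    | single s a =>
      rw [Ψ_single, map_mul, MulOpposite.unop_mul, Module.End.mul_apply, Θ_even, one_mul,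
        map_list_prod, MulOpposite.unop_list_prod, List.map_map, List.map_map, ← List.map_reverse,
        List.reverse_reverse]
      refine Eq.trans ?_ (SuperPair.prod_ind₁_empty (D := D) b ρ s a)
      congr 3
      funext x
      exact homOfOpRep_odd ..
  have bij : Function.Bijective Ψ := by
    refine ⟨fun m m' h => ?_, fun z => ⟨(Θ z).unop (Finsupp.single ∅ 1), ?_⟩⟩
    · rw [← ΘΨ m, ← ΘΨ m', h]
    · rw [ΨΘ, Ψ_single]
      simp
  exact exists_basis_of_bijective (AddEquiv.refl L.EvenEnvelope) _ Ψ.toAddMonoidHom bij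
    fun s a => Ψ_single s a

/-- Decreasing products for the dual order are increasing products for the given one. -/
theorem left_basis (h2 : ∀ a : k, 2 * a = 0 → a = 0) (hL : L.Admissible) {X : Type*}
    [LinearOrder X] (b : Module.Basis X k (L.gr 1)) :
    ∃ B : Module.Basis (Finset X) L.EvenEnvelope L.Envelope, ∀ s, B s = L.orderedProd b s := by
  obtain ⟨B, hB⟩ := left_basis_reverse h2 hL (X := Xᵒᵈ) b
  refine ⟨B, fun s => (hB s).trans ?_⟩
  rw [orderedProd]
  congr 2
  have h := Finset.pairwise_sort (α := Xᵒᵈ) s (· ≤ ·)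
  have p := Finset.sort_perm_toList (α := Xᵒᵈ) s (· ≤ ·)
  exact List.Perm.eq_of_pairwise (α := X) (le := (· ≤ ·)) (fun x y _ _ h h' => le_antisymm h h')
    (List.pairwise_reverse.2 h) (Finset.pairwise_sort (α := X) s (· ≤ ·))
    ((List.reverse_perm _).trans (p.trans (Finset.sort_perm_toList (α := X) s (· ≤ ·)).symm))

end LieSuperalgebra

end

noncomputable section

/-! ### Ordered products in the exterior algebra -/

namespace ExteriorSuper

variable {k V : Type*} [CommRing k] [AddCommGroup V] [Module k V]

theorem isPrim_ι (v : V) : SuperAux.IsPrim (gr k V) (comulAlgHom k V) (counitAlgHom k V) 1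
    (ExteriorAlgebra.ι k v) :=
  ⟨ι_mem k V v, ExteriorAlgebra.lift_ι_apply k _ _ v, ExteriorAlgebra.lift_ι_apply k _ _ v⟩

variable {X : Type*} [LinearOrder X] (b : Module.Basis X k V)

theorem basis_eq_prod (s : Finset X) : b.ExteriorAlgebra s =
    ((s.sort (· ≤ ·)).map fun x => ExteriorAlgebra.ι k (b x)).prod := by
  rw [ExteriorAlgebra.basis_apply_ofCard b rfl, ExteriorAlgebra.ιMulti_family,
    ExteriorAlgebra.ιMulti_apply, Set.powersetCard.ofFinEmbEquiv_symm_apply, ← s.listMap_orderEmbOfFin_finRange rfl,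
    List.map_map, List.ofFn_eq_map]
  rfl

theorem basis_empty : b.ExteriorAlgebra ∅ = 1 := by simp [basis_eq_prod]

theorem basis_insert {y : X} {T : Finset X} (h : ∀ t ∈ T, y < t) :
    b.ExteriorAlgebra (insert y T) = ExteriorAlgebra.ι k (b y) * b.ExteriorAlgebra T := by
  rw [basis_eq_prod, basis_eq_prod, Finset.sort_insert _ (fun t ht => (h t ht).le)
    (fun hy => lt_irrefl _ (h y hy)), List.map_cons, List.prod_cons]

end ExteriorSuper

@[elab_as_elim]
theorem Finset.induction_on_insert_lt {X : Type*} [LinearOrder X] {p : Finset X → Prop}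
    (empty : p ∅) (insert : ∀ y T, (∀ t ∈ T, y < t) → p T → p (insert y T)) (s : Finset X) :
    p s := by
  induction hn : s.card generalizing s with
  | zero => rwa [Finset.card_eq_zero.1 hn]
  | succ n ih =>
    obtain ⟨y, T, rfl, hT, hc⟩ :=
      SuperPair.exists_insert_of_nonempty (S := s) (Finset.card_pos.1 (by omega))
    exact insert y T hT (ih T (by omega))

theorem ExteriorSuper.basis_mem {k V : Type*} [CommRing k] [AddCommGroup V] [Module k V]
    {X : Type*} [LinearOrder X] (b : Module.Basis X k V) (s : Finset X) :
    b.ExteriorAlgebra s ∈ ExteriorSuper.gr k V s.card := by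
  induction s using Finset.induction_on_insert_lt with
  | empty =>
    rw [basis_empty, Finset.card_empty, Nat.cast_zero]
    exact SetLike.one_mem_graded _
  | insert y T hT ih =>
    rw [basis_insert b hT, Finset.card_insert_of_notMem fun h => lt_irrefl _ (hT y h), add_comm,
      Nat.cast_add, Nat.cast_one]
    exact SetLike.GradedMul.mul_mem (ExteriorSuper.ι_mem k V _) ih

namespace LieSuperalgebra

variable {k g : Type*} [CommRing k] [AddCommGroup g] [Module k g] (L : LieSuperalgebra k g)

theorem isPrim_ι {i : ZMod 2} {z : g} (hz : z ∈ L.gr i) :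
    SuperAux.IsPrim L.grEnvelope L.comulAlgHom L.counitAlgHom i (L.ι z) :=
  ⟨L.ι_mem hz, by rw [comulAlgHom, lift_ι]; rfl, by simp [counitAlgHom]⟩

/-! ### The map from `U(g₀)` and the super-coalgebra structure. -/

section evenMap

theorem evenMap_mem (a : L.EvenEnvelope) : L.evenMap a ∈ L.grEnvelope 0 := by
  induction a using UniversalEnvelopingAlgebra.induction_on' with
  | algebraMap c => rw [AlgHom.commutes]; exact SetLike.algebraMap_mem_graded _ _
  | ι u => rw [evenMap_ι]; exact L.ι_mem u.2
  | add x y hx hy => rw [map_add]; exact add_mem hx hy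
  | mul x y hx hy =>
    rw [map_mul]
    simpa only [add_zero] using SetLike.GradedMul.mul_mem hx hy

theorem counit_evenMap (a : L.EvenEnvelope) :
    L.counitAlgHom (L.evenMap a) = LieEnvelope.counitAlgHom k (L.gr 0) a := by
  induction a using UniversalEnvelopingAlgebra.induction_on' with
  | algebraMap c => simp
  | ι u => rw [evenMap_ι, LieEnvelope.counitAlgHom_ι, (L.isPrim_ι u.2).counit]
  | add x y hx hy => simp only [map_add, hx, hy]
  | mul x y hx hy => simp only [map_mul, hx, hy]

theorem parity_zero {A : Type*} [Ring A] [Algebra k A] (𝒜 : ZMod 2 → Submodule k A)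
    [GradedAlgebra 𝒜] : SuperAux.parity 𝒜 0 = LinearMap.id := by
  ext x
  induction x using DirectSum.Decomposition.inductionOn 𝒜 with
  | zero => simp
  | homogeneous m => simp [SuperAux.parity_coe 𝒜 0 m.2]
  | add x y hx hy => rw [map_add, hx, hy, map_add]

/-- Even elements produce no signs, so multiplication by an even primitive in the graded tensor
product agrees with that in the ordinary tensor product (`parity_zero`). The product on the
right-hand side is the ordinary one. -/
theorem comul_evenMap_mul (a : L.EvenEnvelope) (z : L.Envelope) :
    SuperAux.lin L.grEnvelope L.comulAlgHom (L.evenMap a * z) =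
      Algebra.TensorProduct.map L.evenMap L.evenMap (LieEnvelope.comulAlgHom k (L.gr 0) a) *
        SuperAux.lin L.grEnvelope L.comulAlgHom z := by
  induction a using UniversalEnvelopingAlgebra.induction_on' generalizing z with
  | algebraMap c =>
    rw [AlgHom.commutes, AlgHom.commutes, AlgHom.commutes, ← Algebra.smul_def, ← Algebra.smul_def,
      map_smul]
  | ι u =>
    rw [evenMap_ι, SuperAux.lin_mul (L.isPrim_ι u.2), LieEnvelope.comulAlgHom_ι, map_add,
      Algebra.TensorProduct.map_tmul, Algebra.TensorProduct.map_tmul, map_one, evenMap_ι]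
    generalize SuperAux.lin L.grEnvelope L.comulAlgHom z = t
    rw [SuperAux.primMul, parity_zero]
    induction t using TensorProduct.induction_on with
    | zero => simp
    | add x y hx hy => rw [map_add, hx, hy, mul_add]
    | tmul x y => simp [add_mul]
  | add x y hx hy => rw [map_add, add_mul, map_add, hx, hy, map_add, map_add, add_mul]
  | mul x y hx hy => rw [map_mul L.evenMap, mul_assoc, hx, hy, map_mul, map_mul, mul_assoc]

end evenMap

/-! ### Matching the ordered products of the exterior algebra and of the envelope. -/

variable {L} {X : Type*} [LinearOrder X] (b : Module.Basis X k (L.gr 1))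

theorem orderedProd_empty : L.orderedProd b ∅ = 1 := by simp [orderedProd]

theorem orderedProd_insert {y : X} {T : Finset X} (h : ∀ t ∈ T, y < t) :
    L.orderedProd b (insert y T) = L.ι (b y : g) * L.orderedProd b T := by
  rw [orderedProd, orderedProd, Finset.sort_insert _ (fun t ht => (h t ht).le)
    (fun hy => lt_irrefl _ (h y hy)), List.map_cons, List.prod_cons]

theorem orderedProd_mem (s : Finset X) : L.orderedProd b s ∈ L.grEnvelope s.card := by
  induction s using Finset.induction_on_insert_lt with
  | empty =>
    rw [orderedProd_empty, Finset.card_empty, Nat.cast_zero]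
    exact SetLike.one_mem_graded _
  | insert y T hT ih =>
    rw [orderedProd_insert b hT, Finset.card_insert_of_notMem fun h => lt_irrefl _ (hT y h),
      add_comm, Nat.cast_add, Nat.cast_one]
    exact SetLike.GradedMul.mul_mem (L.ι_mem (b y).2) ih

/-- The linear map from the exterior algebra to the universal envelope that identifies the ordered
products of the elements of a basis. -/
def ofExterior : ExteriorAlgebra k (L.gr 1) →ₗ[k] L.Envelope :=
  b.ExteriorAlgebra.constr k (L.orderedProd b)

theorem ofExterior_basis (s : Finset X) :
    ofExterior b (b.ExteriorAlgebra s) = L.orderedProd b s :=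
  b.ExteriorAlgebra.constr_basis k _ s

/-- Both kinds of ordered products have degree the parity of their length, so the map commutes with
the projections to degree `i`. -/
theorem ofExterior_mem {i : ZMod 2} {x : ExteriorAlgebra k (L.gr 1)}
    (hx : x ∈ ExteriorSuper.gr k (L.gr 1) i) : ofExterior b x ∈ L.grEnvelope i := by
  have h : ofExterior b ∘ₗ GradedAlgebra.proj (ExteriorSuper.gr k (L.gr 1)) i =
      GradedAlgebra.proj L.grEnvelope i ∘ₗ ofExterior b := by
    refine b.ExteriorAlgebra.ext fun s => ?_
    simp only [LinearMap.comp_apply, GradedAlgebra.proj_apply, ofExterior_basis]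
    by_cases hs : (s.card : ZMod 2) = i
    · subst hs
      rw [DirectSum.decompose_of_mem_same _ (ExteriorSuper.basis_mem b s),
        DirectSum.decompose_of_mem_same _ (orderedProd_mem b s), ofExterior_basis]
    · rw [DirectSum.decompose_of_mem_ne _ (ExteriorSuper.basis_mem b s) hs,
        DirectSum.decompose_of_mem_ne _ (orderedProd_mem b s) hs, map_zero]
  have h' := LinearMap.congr_fun h x
  simp only [LinearMap.comp_apply, GradedAlgebra.proj_apply,
    DirectSum.decompose_of_mem_same _ hx] at h'
  rw [h']
  exact SetLike.coe_mem _

theorem counit_ofExterior (x : ExteriorAlgebra k (L.gr 1)) :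
    L.counitAlgHom (ofExterior b x) = ExteriorSuper.counitAlgHom k (L.gr 1) x := by
  suffices h : L.counitAlgHom.toLinearMap ∘ₗ ofExterior b =
      (ExteriorSuper.counitAlgHom k (L.gr 1)).toLinearMap from LinearMap.congr_fun h x
  refine b.ExteriorAlgebra.ext fun s => ?_
  simp only [LinearMap.comp_apply, ofExterior_basis, AlgHom.toLinearMap_apply]
  induction s using Finset.induction_on_insert_lt with
  | empty => rw [orderedProd_empty, ExteriorSuper.basis_empty, map_one, map_one]
  | insert y T hT ih =>
    rw [orderedProd_insert b hT, ExteriorSuper.basis_insert b hT, map_mul, map_mul,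
      (L.isPrim_ι (b y).2).counit, (ExteriorSuper.isPrim_ι (b y)).counit, zero_mul, zero_mul]

/-- `ofExterior` is not multiplicative, but it respects left multiplication by `y` on ordered
products in variables above `y`. Since the coproduct of `s` involves only subsets of `s`, adding a
smaller `y` acts identically on both sides, signs included. The support statement is carried along
to make this induction possible. -/
theorem comul_ofExterior_basis (s : Finset X) :
    SuperAux.lin (ExteriorSuper.gr k (L.gr 1)) (ExteriorSuper.comulAlgHom k (L.gr 1))
        (b.ExteriorAlgebra s) ∈
      Submodule.span k {t | ∃ r ⊆ s, ∃ r' ⊆ s, t = b.ExteriorAlgebra r ⊗ₜ[k] b.ExteriorAlgebra r'} ∧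
    SuperAux.lin L.grEnvelope L.comulAlgHom (L.orderedProd b s) =
      TensorProduct.map (ofExterior b) (ofExterior b)
        (SuperAux.lin (ExteriorSuper.gr k (L.gr 1)) (ExteriorSuper.comulAlgHom k (L.gr 1))
          (b.ExteriorAlgebra s)) := by
  induction s using Finset.induction_on_insert_lt with
  | empty =>
    have h1 : ofExterior b (1 : ExteriorAlgebra k (L.gr 1)) = 1 := by
      rw [← ExteriorSuper.basis_empty b, ofExterior_basis, orderedProd_empty]
    rw [ExteriorSuper.basis_empty, orderedProd_empty, SuperAux.lin_one, SuperAux.lin_one,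
      TensorProduct.map_tmul, h1]
    exact ⟨Submodule.subset_span ⟨∅, subset_rfl, ∅, subset_rfl, by
      rw [ExteriorSuper.basis_empty]⟩, rfl⟩
  | insert y T hT ih =>
    rw [ExteriorSuper.basis_insert b hT, orderedProd_insert b hT,
      SuperAux.lin_mul (ExteriorSuper.isPrim_ι (b y)), SuperAux.lin_mul (L.isPrim_ι (b y).2), ih.2]
    obtain ⟨ih, -⟩ := ih
    generalize SuperAux.lin (ExteriorSuper.gr k (L.gr 1)) (ExteriorSuper.comulAlgHom k (L.gr 1))
      (b.ExteriorAlgebra T) = t at ih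
    induction ih using Submodule.span_induction with
    | zero => simp
    | add t t' _ _ h h' =>
      simp only [map_add]
      exact ⟨add_mem h.1 h'.1, congrArg₂ _ h.2 h'.2⟩
    | smul c t _ h =>
      simp only [map_smul]
      exact ⟨Submodule.smul_mem _ c h.1, congrArg _ h.2⟩
    | mem t ht =>
      obtain ⟨r, hr, r', hr', rfl⟩ := ht
      have hy : ∀ t ∈ r, y < t := fun t ht => hT t (hr ht)
      have hy' : ∀ t ∈ r', y < t := fun t ht => hT t (hr' ht)
      simp only [SuperAux.primMul, LinearMap.add_apply, TensorProduct.map_tmul, LinearMap.id_apply,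
        LinearMap.mulLeft_apply, ← ExteriorSuper.basis_insert b hy,
        ← ExteriorSuper.basis_insert b hy', map_add,
        SuperAux.parity_coe _ _ (ExteriorSuper.basis_mem b r), ofExterior_basis,
        orderedProd_insert b hy, orderedProd_insert b hy',
        SuperAux.parity_coe _ _ (orderedProd_mem b r), Units.smul_def, map_zsmul]
      refine ⟨add_mem (Submodule.subset_span ⟨_, Finset.insert_subset_insert y hr, _,
        hr'.trans (Finset.subset_insert _ _), rfl⟩) ?_, trivial⟩
      rw [← Int.cast_smul_eq_zsmul k, ← TensorProduct.smul_tmul']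
      exact Submodule.smul_mem _ _ (Submodule.subset_span ⟨_, hr.trans (Finset.subset_insert _ _), _,
        Finset.insert_subset_insert y hr', rfl⟩)

theorem comul_ofExterior (x : ExteriorAlgebra k (L.gr 1)) :
    SuperAux.lin L.grEnvelope L.comulAlgHom (ofExterior b x) =
      TensorProduct.map (ofExterior b) (ofExterior b)
        (SuperAux.lin (ExteriorSuper.gr k (L.gr 1)) (ExteriorSuper.comulAlgHom k (L.gr 1)) x) := by
  suffices h : SuperAux.lin L.grEnvelope L.comulAlgHom ∘ₗ ofExterior b =
      TensorProduct.map (ofExterior b) (ofExterior b) ∘ₗ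
        SuperAux.lin (ExteriorSuper.gr k (L.gr 1)) (ExteriorSuper.comulAlgHom k (L.gr 1)) from
    LinearMap.congr_fun h x
  refine b.ExteriorAlgebra.ext fun s => ?_
  rw [LinearMap.comp_apply, ofExterior_basis]
  exact (comul_ofExterior_basis b s).2

/-! ### The isomorphism of super-coalgebras. -/

/-- The linear map `U(g₀) ⊗ ⋀ g₁ → 𝐔(g)` given by a basis of `g₁`. -/
def ofTensor : L.EvenEnvelope ⊗[k] ExteriorAlgebra k (L.gr 1) →ₗ[k] L.Envelope :=
  LinearMap.mul' k L.Envelope ∘ₗ TensorProduct.map L.evenMap.toLinearMap (ofExterior b)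

theorem ofTensor_tmul (a : L.EvenEnvelope) (x : ExteriorAlgebra k (L.gr 1)) :
    ofTensor b (a ⊗ₜ x) = L.evenMap a * ofExterior b x := rfl

theorem ofTensor_smul (a : L.EvenEnvelope) (t : L.EvenEnvelope ⊗[k] ExteriorAlgebra k (L.gr 1)) :
    ofTensor b (a • t) = a • ofTensor b t := by
  induction t using TensorProduct.induction_on with
  | zero => simp
  | add x y hx hy => simp only [smul_add, map_add, hx, hy]
  | tmul c x =>
    rw [TensorProduct.smul_tmul', ofTensor_tmul, ofTensor_tmul, smul_eq_mul, map_mul, mul_assoc]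
    rfl

/-- The map carries the `U(g₀)`-basis extended from the exterior algebra to the basis of
`left_basis`. -/
theorem ofTensor_bijective (h2 : ∀ a : k, 2 * a = 0 → a = 0) (hL : L.Admissible) :
    Function.Bijective (ofTensor b) := by
  obtain ⟨B, hB⟩ := left_basis h2 hL b
  let e := (Algebra.TensorProduct.basis L.EvenEnvelope b.ExteriorAlgebra).equiv B (Equiv.refl _)
  have key : ∀ t, ofTensor b t = e t := by
    intro t
    induction t using TensorProduct.induction_on with
    | zero => simp
    | add x y hx hy => simp only [map_add, hx, hy]
    | tmul a x =>
      induction x using SuperPair.basis_induction b.ExteriorAlgebra generalizing a with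
      | zero => simp
      | add v w hv hw => simp only [TensorProduct.tmul_add, map_add, hv, hw]
      | smul c v hv => rw [← TensorProduct.smul_tmul, hv]
      | basis s =>
        rw [← Algebra.TensorProduct.basis_repr_symm_apply', ofTensor_smul, map_smul,
          Module.Basis.equiv_apply, Algebra.TensorProduct.basis_apply, ofTensor_tmul, map_one,
          one_mul, ofExterior_basis, Equiv.refl_apply, hB]
  have : ⇑(ofTensor b) = e := funext key
  rw [this]
  exact e.bijective

/-- The map `U(g₀) ⊗ ⋀ g₁ → 𝐔(g)` is a map of coalgebras. -/
def coalgHomOfTensor : (L.EvenEnvelope ⊗[k] ExteriorAlgebra k (L.gr 1)) →ₗc[k] L.Envelope where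
  toLinearMap := ofTensor b
  counit_comp := by
    refine TensorProduct.ext' fun a x => ?_
    change L.counitAlgHom (L.evenMap a * ofExterior b x) = _
    rw [map_mul, counit_evenMap, counit_ofExterior, TensorProduct.counit_tmul, smul_eq_mul, mul_comm]
    rfl
  map_comp_comul := by
    refine TensorProduct.ext' fun a x => ?_
    change _ = SuperAux.lin L.grEnvelope L.comulAlgHom (L.evenMap a * ofExterior b x)
    rw [comul_evenMap_mul, comul_ofExterior, LinearMap.comp_apply, TensorProduct.comul_tmul]
    change TensorProduct.map (ofTensor b) (ofTensor b)
      (TensorProduct.AlgebraTensorModule.tensorTensorTensorComm k k k k _ _ _ _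
        (LieEnvelope.comulAlgHom k (L.gr 0) a ⊗ₜ[k] SuperAux.lin (ExteriorSuper.gr k (L.gr 1))
          (ExteriorSuper.comulAlgHom k (L.gr 1)) x)) = _
    generalize LieEnvelope.comulAlgHom k (L.gr 0) a = s
    generalize SuperAux.lin (ExteriorSuper.gr k (L.gr 1))
      (ExteriorSuper.comulAlgHom k (L.gr 1)) x = t
    induction s using TensorProduct.induction_on with
    | zero => simp
    | add s s' h h' => simp only [TensorProduct.add_tmul, map_add, add_mul, h, h']
    | tmul a a' =>
      induction t using TensorProduct.induction_on with
      | zero => simp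
      | add s s' h h' => simp only [TensorProduct.tmul_add, map_add, mul_add, h, h']
      | tmul x x' => simp [ofTensor_tmul]

theorem superTensorGr_sup (i : ZMod 2) :
    superTensorGr (purelyEven k L.EvenEnvelope) (ExteriorSuper.gr k (L.gr 1)) i ⊔
      superTensorGr (purelyEven k L.EvenEnvelope) (ExteriorSuper.gr k (L.gr 1)) (i + 1) = ⊤ := by
  have mem : ∀ (j : ZMod 2) (a : L.EvenEnvelope) {x : ExteriorAlgebra k (L.gr 1)},
      x ∈ ExteriorSuper.gr k (L.gr 1) j →
      a ⊗ₜ x ∈ superTensorGr (purelyEven k L.EvenEnvelope) (ExteriorSuper.gr k (L.gr 1)) j := by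
    intro j a x hx
    -- `U(g₀)` is purely even, so the summand with first factor of degree 0 is the one to use.
    refine Submodule.mem_iSup_of_mem 0 ⟨⟨a, by simp [purelyEven]⟩ ⊗ₜ ⟨x, by simpa using hx⟩, ?_⟩
    simp [TensorProduct.mapIncl]
  have or : ∀ i j : ZMod 2, j = i ∨ j = i + 1 := by decide
  rw [eq_top_iff]
  rintro t -
  induction t using TensorProduct.induction_on with
  | zero => exact zero_mem _
  | add x y hx hy => exact add_mem hx hy
  | tmul a x =>
    induction x using DirectSum.Decomposition.inductionOn (ExteriorSuper.gr k (L.gr 1)) with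
    | zero => rw [TensorProduct.tmul_zero]; exact zero_mem _
    | add x y hx hy => rw [TensorProduct.tmul_add]; exact add_mem hx hy
    | @homogeneous j m =>
      rcases or i j with rfl | rfl
      · exact Submodule.mem_sup_left (mem _ a m.2)
      · exact Submodule.mem_sup_right (mem _ a m.2)

theorem ofTensor_mem {i : ZMod 2} {t : L.EvenEnvelope ⊗[k] ExteriorAlgebra k (L.gr 1)}
    (ht : t ∈ superTensorGr (purelyEven k L.EvenEnvelope) (ExteriorSuper.gr k (L.gr 1)) i) :
    ofTensor b t ∈ L.grEnvelope i := by
  suffices h : superTensorGr (purelyEven k L.EvenEnvelope) (ExteriorSuper.gr k (L.gr 1)) i ≤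
    (L.grEnvelope i).comap (ofTensor b) from h ht
  refine iSup_le fun j => ?_
  rintro _ ⟨s, rfl⟩
  induction s using TensorProduct.induction_on with
  | zero => rw [map_zero]; exact zero_mem _
  | add x y hx hy => rw [map_add]; exact add_mem hx hy
  | tmul a x =>
    change L.evenMap (a : L.EvenEnvelope) * ofExterior b x ∈ L.grEnvelope i
    rcases ZMod.eq_zero_or_one j with rfl | rfl
    · have h := SetLike.GradedMul.mul_mem (L.evenMap_mem (a : L.EvenEnvelope))
        (ofExterior_mem b x.2)
      simpa only [zero_add, sub_zero] using h
    · have ha : (a : L.EvenEnvelope) = 0 := by simpa [purelyEven] using a.2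
      rw [ha, map_zero, zero_mul]
      exact zero_mem _

/-- For the converse, split `t` into parts of degrees `i` and `i + 1`. The image of the second part
lies in both degrees of the envelope, hence vanishes, and injectivity removes that part. -/
theorem ofTensor_mem_iff (h2 : ∀ a : k, 2 * a = 0 → a = 0) (hL : L.Admissible) (i : ZMod 2)
    (t : L.EvenEnvelope ⊗[k] ExteriorAlgebra k (L.gr 1)) : ofTensor b t ∈ L.grEnvelope i ↔
      t ∈ superTensorGr (purelyEven k L.EvenEnvelope) (ExteriorSuper.gr k (L.gr 1)) i := by
  refine ⟨fun h => ?_, ofTensor_mem b⟩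
  obtain ⟨t₀, h₀, t₁, h₁, rfl⟩ := Submodule.mem_sup.1
    (superTensorGr_sup (L := L) i ▸ Submodule.mem_top (x := t))
  have m₁ : ofTensor b t₁ ∈ L.grEnvelope i := by
    have := sub_mem h (ofTensor_mem b h₀)
    rwa [map_add, add_sub_cancel_left] at this
  have z₁ : ofTensor b t₁ = 0 := by
    rw [← DirectSum.decompose_of_mem_same _ m₁]
    exact DirectSum.decompose_of_mem_ne _ (ofTensor_mem b h₁)
      (by rw [ne_eq, add_eq_left]; decide)
  rw [(ofTensor_bijective b h2 hL).1 (z₁.trans (map_zero _).symm), add_zero]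
  exact h₀

end LieSuperalgebra

end

/-- For the tensor product of super-coalgebras `U(g₀) ⊗ ⋀ g₁`, the super-symmetry in the definition
of the coproduct is the ordinary flip, because `U(g₀)` is purely even; so its coalgebra structure
is the one of the ordinary tensor product of coalgebras. -/
theorem proposition3 {k g : Type*} [CommRing k] [Nontrivial k]
    (h2 : ∀ a : k, 2 * a = 0 → a = 0)
    [AddCommGroup g] [Module k g] (L : LieSuperalgebra k g) (hL : L.Admissible) :
    (Module.Free L.EvenEnvelope L.Envelope ∧ Module.Free (L.EvenEnvelope)ᵐᵒᵖ L.Envelope) ∧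
    (∀ {X : Type*} [LinearOrder X] (b : Module.Basis X k (L.gr 1)),
      (∃ B : Module.Basis (Finset X) L.EvenEnvelope L.Envelope,
        ∀ s, B s = L.orderedProd b s) ∧
      (∃ B : Module.Basis (Finset X) (L.EvenEnvelope)ᵐᵒᵖ L.Envelope,
        ∀ s, B s = L.orderedProd b s)) ∧
    (∃ φ : (L.EvenEnvelope ⊗[k] ExteriorAlgebra k (L.gr 1)) ≃ₗc[k] L.Envelope,
      (∀ (a : L.EvenEnvelope) (t : L.EvenEnvelope ⊗[k] ExteriorAlgebra k (L.gr 1)),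
        φ (a • t) = a • φ t) ∧
      (∀ (i : ZMod 2) (t : L.EvenEnvelope ⊗[k] ExteriorAlgebra k (L.gr 1)),
        φ t ∈ L.grEnvelope i ↔
          t ∈ superTensorGr (purelyEven k L.EvenEnvelope) (ExteriorSuper.gr k (L.gr 1)) i) ∧
      φ (1 ⊗ₜ 1) = 1) := by
  refine ⟨?_, fun b => ⟨LieSuperalgebra.left_basis h2 hL b, LieSuperalgebra.right_basis h2 hL b⟩, ?_⟩
  all_goals
    classical
    have := hL.free_odd
    let b := Module.Free.chooseBasis k (L.gr 1)
    -- Any total order on the chosen basis would serve; a well-order is one that always exists.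
    let _ : LinearOrder (Module.Free.ChooseBasisIndex k (L.gr 1)) :=
      linearOrderOfSTO WellOrderingRel
  · obtain ⟨B, -⟩ := LieSuperalgebra.left_basis h2 hL b
    obtain ⟨B', -⟩ := LieSuperalgebra.right_basis h2 hL b
    exact ⟨Module.Free.of_basis B, Module.Free.of_basis B'⟩
  · refine ⟨CoalgEquiv.ofBijective (f := LieSuperalgebra.coalgHomOfTensor b)
      (LieSuperalgebra.ofTensor_bijective b h2 hL), LieSuperalgebra.ofTensor_smul b,
      LieSuperalgebra.ofTensor_mem_iff b h2 hL, ?_⟩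
    change L.evenMap 1 * LieSuperalgebra.ofExterior b 1 = 1
    rw [map_one, one_mul, ← ExteriorSuper.basis_empty b, LieSuperalgebra.ofExterior_basis,
      LieSuperalgebra.orderedProd_empty]
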